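/- Let $q$ be a prime power, $m\ge 1$, and let $V$ be an $m$-dimensional vector space over $\mathbb F_q$; let $V^*=V\setminus\{0\}$ and let $\mathscr Q(m,q)$ be the set of quadratic forms on $V$. The rank of $Q\in\mathscr Q(m,q)$ is the codimension of $\{x\in V: Q(x)=0,\ Q(x+y)-Q(x)-Q(y)=0 \text{ for all } y\in V\}$. Let $\mathscr Q_{2s+1}$ be the set of forms of rank $2s+1$. Let $\mathscr Q_{2s,1}$ (hyperbolic forms) and $\mathscr Q_{2s,-1}$ (elliptic forms, $s\ge 1$; put $\mathscr Q_{0,-1}=\emptyset$) be the sets of forms that, in suitable coordinates and up to a nonzero scalar factor, equal $\sum_{i=1}^{s}x_{2i-1}x_{2i}$ and $\sum_{i=1}^{s-1}x_{2i-1}x_{2i}+Q_0$, respectively, where $Q_0=x_{2s-1}^2+x_{2s-1}x_{2s}+\alpha x_{2s}^2$ with $\alpha$ of absolute trace $1$ if $q$ is even, and $Q_0=x_{2s-1}^2-\beta x_{2s}^2$ with $\beta$ a nonsquare if $q$ is odd. Let $I$ be the set of indices $2s+1\le m$ ($s\ge 0$) and $(2s,\tau)$ with $0\le 2s\le m$,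 $\tau=\pm1$. The inner distribution $(a_i)_{i\in I}$ of a nonempty set $Y\subseteq\mathscr Q(m,q)$ is $$a_i=\frac{|\{(A,B)\in Y\times Y: A-B\in\mathscr Q_i\}|}{|Y|}.$$ Call $Y$ nondegenerate if $q>2$, or if $q=2$ and no two elements of $Y$ differ by a form of rank $1$. Let $R_q(1,m)^*$ be the set of all $q^{m+1}$ affine functions $V\to\mathbb F_q$ and let $$\mathcal C(Y)=\bigcup_{Q\in Y}\bigl(Q+R_q(1,m)^*\bigr).$$ The weight $\mathrm{wt}(f)$ of a function $f:V\to\mathbb F_q$ is the number of $x\in V^*$ with $f(x)\neq 0$, and the distance enumerator of a nonempty set $\mathcal C$ of functions is $\frac{1}{|\mathcal C|}\sum_{b,c\in\mathcal C}z^{\mathrm{wt}(c-b)}$. For $i\in I$ let $\omega_i(z)=\sum_{j=1}^6 n_jz^{w_j}$, where \begin{align*} w_1&=q^{m-1}(q-1)-q^{m-s-1}-1 & n_1&=\tfrac12(q^{2s}(q-1)-q^s)(q-1)\\ w_2&=q^{m-1}(q-1)-q^{m-s-1} & n_2&=\tfrac12(q^{2s}+q^s)(q-1)\\ w_3&=q^{m-1}(q-1)-1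 & n_3&=(q^m-q^{2s}(q-1))(q-1)\\ w_4&=q^{m-1}(q-1) & n_4&=q^m-q^{2s}(q-1)\\ w_5&=q^{m-1}(q-1)+q^{m-s-1}-1 & n_5&=\tfrac12(q^{2s}(q-1)+q^s)(q-1)\\ w_6&=q^{m-1}(q-1)+q^{m-s-1} & n_6&=\tfrac12(q^{2s}-q^s)(q-1) \end{align*} for $i=2s+1$, and \begin{align*} w_1&=(q^{m-1}-\tau q^{m-s-1})(q-1)-1 & n_1&=(q^{2s-1}-\tau q^{s-1})(q-1)\\ w_2&=(q^{m-1}-\tau q^{m-s-1})(q-1) & n_2&=q^{2s-1}+\tau q^{s-1}(q-1)\\ w_3&=q^{m-1}(q-1)-1 & n_3&=(q^m-q^{2s})(q-1)\\ w_4&=q^{m-1}(q-1) & n_4&=q^m-q^{2s}\\ w_5&=q^{m-1}(q-1)+\tau q^{m-s-1}-1 & n_5&=(q^{2s-1}(q-1)+\tau q^{s-1})(q-1)\\ w_6&=q^{m-1}(q-1)+\tau q^{m-s-1} & n_6&=(q^{2s-1}-\tau q^{s-1})(q-1) \end{align*} for $i=(2s,\tau)$. (If $\mathscr Q_i\ne\emptyset$,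 a negative exponent occurs only with coefficient $0$, and that term is dropped; if $\mathscr Q_i=\emptyset$ then $a_i=0$.) **Theorem.** Let $Y$ be a nonempty nondegenerate subset of $\mathscr Q(m,q)$ with inner distribution $(a_i)_{i\in I}$. Then the distance enumerator of $\mathcal C(Y)$ is $\sum_{i\in I}a_i\,\omega_i(z)$. Moreover, if $m(q-1)>2$, then the same polynomial is the distance enumerator, with respect to the Hamming weight, of the code $\{(f(x))_{x\in V^*}: f\in\mathcal C(Y)\}\subseteq\mathbb F_q^{V^*}$ of length $q^m-1$. -/

import Mathlib

open Polynomial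

namespace QuadraticCode

section Forms

variable {F : Type*} [Field F] {V : Type*} [AddCommGroup V] [Module F V]

/-- The rank of a quadratic form: the codimension of its radical, which consists of all `x` with
`Q x = 0` that lie in the radical of the bilinear form `(x, y) ↦ Q (x + y) - Q x - Q y`. -/
noncomputable def rank (Q : QuadraticForm F V) : ℕ :=
  Module.finrank F (V ⧸ QuadraticMap.radical Q)

/-- The coordinate functional `x ↦ x j` on `F ^ m`, counted from `j = 0`.
(It is set to `0` when `j` is out of range, which does not occur for forms of rank at most `m`.) -/
noncomputable def coord (F : Type*) [Field F] (m j : ℕ) : (Fin m → F) →ₗ[F] F :=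
  if h : j < m then LinearMap.proj ⟨j, h⟩ else 0

/-- The form `x₀ x₁ + x₂ x₃ + ⋯` on `F ^ m` with `s` summands. -/
noncomputable def hyperbolicSum (F : Type*) [Field F] (m s : ℕ) : QuadraticForm F (Fin m → F) :=
  ∑ i ∈ Finset.range s, QuadraticMap.linMulLin (coord F m (2 * i)) (coord F m (2 * i + 1))

/-- The form `a x ^ 2 + b x y + c y ^ 2` in the two coordinates `x = x_j` and `y = x_{j+1}`. -/
noncomputable def binaryForm {F : Type*} [Field F] (m j : ℕ) (a b c : F) :
    QuadraticForm F (Fin m → F) :=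
  a • QuadraticMap.linMulLin (coord F m j) (coord F m j)
    + b • QuadraticMap.linMulLin (coord F m j) (coord F m (j + 1))
    + c • QuadraticMap.linMulLin (coord F m (j + 1)) (coord F m (j + 1))

/-- The absolute trace `y ^ p + y ^ (p ^ 2) + ⋯ + y ^ (p ^ k)` on a field with `p ^ k` elements,
with values in the prime field, regarded as a subfield. -/
noncomputable def absTrace {F : Type*} [Field F] (y : F) : F :=
  ∑ i ∈ Finset.Icc 1 (Nat.log (ringChar F) (Nat.card F)), y ^ (ringChar F ^ i)

/-- `Q` is represented by `R` in suitable coordinates, up to a nonzero scalar factor: it lies in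
the orbit of `R` under the group `Fˣ × GL(V)`. -/
def InOrbit (R : QuadraticForm F (Fin (Module.finrank F V) → F)) (Q : QuadraticForm F V) : Prop :=
  ∃ (a : Fˣ) (L : V ≃ₗ[F] (Fin (Module.finrank F V) → F)), ∀ x, Q x = (a : F) * R (L x)

/-- `Q` is in the orbit of the canonical hyperbolic form of rank `2 s`. -/
def IsHyperbolic (s : ℕ) (Q : QuadraticForm F V) : Prop :=
  InOrbit (hyperbolicSum F (Module.finrank F V) s) Q

/-- `Q` is in the orbit of the canonical elliptic form of rank `2 s`, `s ≥ 1`. The orbit does not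
depend on the element `α` of absolute trace `1`, or on the nonsquare `β`, respectively. -/
def IsElliptic (s : ℕ) (Q : QuadraticForm F V) : Prop :=
  1 ≤ s ∧
    ((ringChar F = 2 ∧ ∃ α : F, absTrace α = 1 ∧
        InOrbit (hyperbolicSum F (Module.finrank F V) (s - 1)
          + binaryForm (Module.finrank F V) (2 * (s - 1)) 1 1 α) Q) ∨
      (ringChar F ≠ 2 ∧ ∃ β : F, ¬ IsSquare β ∧
        InOrbit (hyperbolicSum F (Module.finrank F V) (s - 1)
          + binaryForm (Module.finrank F V) (2 * (s - 1)) 1 0 (-β)) Q))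

/-- The indices of the classes: `Sum.inl s` stands for the odd rank `2 s + 1`, and
`Sum.inr (s, τ)` for the even rank `2 s` and the type `τ = ± 1`. -/
abbrev Index : Type := ℕ ⊕ (ℕ × ℤˣ)

/-- The indices whose rank is at most `m`; all other classes of forms on an `m`-dimensional
space are empty. -/
def indices (m : ℕ) : Finset Index :=
  ((Finset.range (m + 1)).filter fun s => 2 * s + 1 ≤ m).disjSum
    (((Finset.range (m + 1)).filter fun s => 2 * s ≤ m) ×ˢ (Finset.univ : Finset ℤˣ))

/-- The class of all quadratic forms on `V` with a given index. -/
def formClass (F : Type*) [Field F] (V : Type*) [AddCommGroup V] [Module F V] :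
    Index → Set (QuadraticForm F V)
  | Sum.inl s => {Q | rank Q = 2 * s + 1}
  | Sum.inr (s, τ) =>
      {Q | rank Q = 2 * s ∧ ((τ = 1 ∧ IsHyperbolic s Q) ∨ (τ = -1 ∧ IsElliptic s Q))}

/-- The inner distribution of `Y`: the number of pairs in `Y × Y` whose difference lies in the
class `i`, divided by the size of `Y`. -/
noncomputable def innerDist (Y : Set (QuadraticForm F V)) (i : Index) : ℚ :=
  (({p : QuadraticForm F V × QuadraticForm F V |
      p.1 ∈ Y ∧ p.2 ∈ Y ∧ p.1 - p.2 ∈ formClass F V i}.ncard : ℕ) : ℚ) / (Y.ncard : ℚ)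

/-- Over the field with two elements a form of rank one is also a linear function, so that two
forms that differ by a form of rank one give the same coset of the affine functions. A set `Y` is
nondegenerate if this does not happen in it. -/
def Nondegenerate (Y : Set (QuadraticForm F V)) : Prop :=
  2 < Nat.card F ∨ ∀ A ∈ Y, ∀ B ∈ Y, rank (A - B) ≠ 1

/-- The affine functions from `V` to `F`. -/
def affineFunctions (F : Type*) [Field F] (V : Type*) [AddCommGroup V] [Module F V] :
    Set (V → F) :=
  {f | ∃ g : V →ᵃ[F] F, ∀ x, f x = g x}

/-- The union of the cosets `Q + {affine functions}` for `Q ∈ Y`, as a set of functions on `V`. -/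
def code (Y : Set (QuadraticForm F V)) : Set (V → F) :=
  ⋃ Q ∈ Y, {f | ∃ g ∈ affineFunctions F V, f = (fun x => Q x) + g}

/-- The vector of the values of a function at the nonzero points. -/
def puncture (f : V → F) : {x : V // x ≠ 0} → F := fun x => f x

/-- The code of `Y` as a set of vectors, with one coordinate for every nonzero point of `V`. -/
def puncturedCode (Y : Set (QuadraticForm F V)) : Set ({x : V // x ≠ 0} → F) :=
  puncture '' code Y

end Forms

section Codes

/-- The Hamming weight: the number of nonzero entries of a vector. -/
noncomputable def weight {ι F : Type*} [Zero F] (c : ι → F) : ℕ := {i | c i ≠ 0}.ncard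

/-- The distance enumerator of a code `C` with respect to a weight function `wt`:
`|C|⁻¹ ∑ z ^ wt (c - b)` over all `b, c ∈ C`. -/
noncomputable def distanceEnumerator {A : Type*} [AddGroup A] [Finite A] (wt : A → ℕ)
    (C : Set A) : ℚ[X] :=
  Polynomial.C ((C.ncard : ℚ)⁻¹) *
    ∑ b ∈ (Set.toFinite C).toFinset, ∑ c ∈ (Set.toFinite C).toFinset, X ^ wt (c - b)

/-- The polynomials `ω_i`, for an index `i` of rank at most `m`, where `m ≥ 1`. The coefficients
are computed in `ℚ`. For such indices of nonempty classes the exponents are nonnegative, except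
that the exponent of the first term is `-1` (truncated to `0` here) for the zero form, and for
rank one when `q = 2`; the coefficient of that term is `0` in both cases. -/
noncomputable def omega (q m : ℕ) : Index → ℚ[X]
  | Sum.inl s =>
      C ((1 / 2 : ℚ) * ((q : ℚ) ^ (2 * s) * (q - 1) - (q : ℚ) ^ s) * (q - 1))
          * X ^ (q ^ (m - 1) * (q - 1) - q ^ (m - s - 1) - 1)
        + C ((1 / 2 : ℚ) * ((q : ℚ) ^ (2 * s) + (q : ℚ) ^ s) * (q - 1))
          * X ^ (q ^ (m - 1) * (q - 1) - q ^ (m - s - 1))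
        + C (((q : ℚ) ^ m - (q : ℚ) ^ (2 * s) * (q - 1)) * (q - 1))
          * X ^ (q ^ (m - 1) * (q - 1) - 1)
        + C ((q : ℚ) ^ m - (q : ℚ) ^ (2 * s) * (q - 1))
          * X ^ (q ^ (m - 1) * (q - 1))
        + C ((1 / 2 : ℚ) * ((q : ℚ) ^ (2 * s) * (q - 1) + (q : ℚ) ^ s) * (q - 1))
          * X ^ (q ^ (m - 1) * (q - 1) + q ^ (m - s - 1) - 1)
        + C ((1 / 2 : ℚ) * ((q : ℚ) ^ (2 * s) - (q : ℚ) ^ s) * (q - 1))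
          * X ^ (q ^ (m - 1) * (q - 1) + q ^ (m - s - 1))
  | Sum.inr (s, τ) =>
      let t : ℤ := (τ : ℤ)
      let w (n : ℤ) : ℕ := n.toNat
      C (((q : ℚ) ^ (2 * (s : ℤ) - 1) - t * (q : ℚ) ^ ((s : ℤ) - 1)) * (q - 1))
          * X ^ w (((q : ℤ) ^ (m - 1) - t * (q : ℤ) ^ (m - s - 1)) * (q - 1) - 1)
        + C ((q : ℚ) ^ (2 * (s : ℤ) - 1) + t * (q : ℚ) ^ ((s : ℤ) - 1) * (q - 1))
          * X ^ w (((q : ℤ) ^ (m - 1) - t * (q : ℤ) ^ (m - s - 1)) * (q - 1))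
        + C (((q : ℚ) ^ m - (q : ℚ) ^ (2 * s)) * (q - 1))
          * X ^ w ((q : ℤ) ^ (m - 1) * (q - 1) - 1)
        + C ((q : ℚ) ^ m - (q : ℚ) ^ (2 * s))
          * X ^ w ((q : ℤ) ^ (m - 1) * (q - 1))
        + C (((q : ℚ) ^ (2 * (s : ℤ) - 1) * (q - 1) + t * (q : ℚ) ^ ((s : ℤ) - 1)) * (q - 1))
          * X ^ w ((q : ℤ) ^ (m - 1) * (q - 1) + t * (q : ℤ) ^ (m - s - 1) - 1)
        + C (((q : ℚ) ^ (2 * (s : ℤ) - 1) - t * (q : ℚ) ^ ((s : ℤ) - 1)) * (q - 1))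
          * X ^ w ((q : ℤ) ^ (m - 1) * (q - 1) + t * (q : ℤ) ^ (m - s - 1))

end Codes

end QuadraticCode

/-!
# Distance enumerators of codes from sets of quadratic forms

The code attached to `Y` is the disjoint union of the cosets `Q + {affine functions}`, `Q ∈ Y`;
the union is disjoint because `Y` is nondegenerate (`eq_zero_of_eq_linear`). Hence the distance
enumerator is the average, over `A ∈ Y`, of the sum over `B ∈ Y` of the weight enumerators of the
cosets of `A - B`, and everything reduces to two facts about a single quadratic form `Q`: it lies
in exactly one class, and the weight enumerator of its coset is the polynomial `ω` of that class
(`exists_unique_index`).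

*Classification.* Splitting off hyperbolic planes as long as there is a singular vector outside the
radical leaves an anisotropic form plus a zero form; by the Chevalley–Warning theorem the
anisotropic part has `r ≤ 2` variables (`exists_decomposes`). The rank is `2 s + r`. The case
`r = 0` is the hyperbolic one. For `r = 2` the anisotropic part is a multiple of the standard
elliptic form (`exists_binary_normal_form`); in characteristic two this uses that elements outside
the image of `t ↦ t ^ 2 + t` have trace one. Hyperbolic and elliptic forms of equal rank are told
apart by their numbers of zeros (`Decomposes.not_elliptic`).

*Weights.* The weight of `Q + l + c` on the nonzero points is determined by its number of zeros on
`V` and by whether its value `c` at the origin vanishes. So the weight enumerator of the coset is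
an instance of `affineSum`, the sum over all `(l, c)` of a function of these two data. A linear
function `l` that is not constant along the radical makes `Q + l + c` equidistributed
(`affineSum_prod_radical`). On the hyperbolic planes, `x y + u x + v y + c` is a translate of
`x y + c - u v`, so that these planes act on `affineSum` by an explicit linear transformation
(`affineSum_dotProduct_add`). What remains is the anisotropic part: a point, a line, where one
counts quadratic polynomials by their number of roots, uniformly in the characteristic
(`affineSum_one`), or a plane, where the polar form is nondegenerate and the form represents all
nonzero values equally often (`affineSum_two`).

*Puncturing.* If `Q + l + c` vanishes at all nonzero points and `m (q - 1) > 2`, then `c = 0`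
(`eq_zero_of_vanish_off_zero`), so that deleting the origin is injective on the code.
-/

namespace QuadraticCode

set_option linter.unusedSectionVars false

/-! ### Counting zeros, and reduction of sums over affine functions -/

section Counting

variable {F : Type*} [Field F]

/-- The number of zeros of a function. -/
noncomputable def zeros {W : Type*} (f : W → F) : ℕ := {x | f x = 0}.ncard

lemma zeros_comp_equiv {V W : Type*} (e : V ≃ W) (f : W → F) :
    zeros (fun x => f (e x)) = zeros f := by
  unfold zeros
  rw [← Nat.card_coe_set_eq, ← Nat.card_coe_set_eq]
  exact Nat.card_congr (e.subtypeEquiv fun x => by simp)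

lemma ncard_setOf_eq_sum {W : Type*} [Fintype W] (p : W → Prop) [DecidablePred p] :
    {x | p x}.ncard = ∑ x, if p x then 1 else 0 := by
  rw [Set.ncard_eq_toFinset_card', Finset.card_eq_sum_ones, ← Finset.sum_filter]
  congr 1
  ext; simp

/-- A function that increases with slope one along some direction takes all values equally
often. -/
lemma card_mul_ncard_fiber {W : Type*} [AddCommGroup W] [Module F W] (f : W → F) (v : W)
    (h : ∀ (x : W) (a : F), f (x + a • v) = f x + a) (t : F) :
    Nat.card F * {x | f x = t}.ncard = Nat.card W := by
  rw [← Nat.card_coe_set_eq, ← Nat.card_prod]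
  refine Nat.card_congr
    { toFun := fun p => p.2.1 + (p.1 - t) • v
      invFun := fun x => (f x, ⟨x + (t - f x) • v, by simp [h]⟩)
      left_inv := ?_
      right_inv := ?_ }
  · rintro ⟨c, x, hx⟩
    have hx' : f x = t := hx
    ext
    · simp [h, hx']
    · simp only [h, hx', add_sub_cancel, add_assoc, ← add_smul]
      simp
  · intro x
    simp only [add_assoc, ← add_smul]
    simp

lemma card_mul_ncard_linear_fiber {W : Type*} [AddCommGroup W] [Module F W] {l : W →ₗ[F] F}
    (hl : l ≠ 0) (t : F) : Nat.card F * {x | l x = t}.ncard = Nat.card W := by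
  obtain ⟨v, hv⟩ : ∃ v, l v ≠ 0 := by
    by_contra! h
    exact hl (LinearMap.ext h)
  exact card_mul_ncard_fiber l ((l v)⁻¹ • v) (fun x a => by simp [hv]) t

end Counting

section AffineSum

variable {F : Type*} [Field F] [Fintype F] [DecidableEq F]
variable {A : Type*} [AddCommGroup A] [Module ℚ A]

/-- The sum over all affine functions `l + c` of a weight that depends on the number of zeros of
`f + l + c` and on whether the constant term `c` vanishes: the weight is given by `Φ₀` if `c = 0`
and by `Φ₁` otherwise. -/
noncomputable def affineSum {W : Type*} [AddCommGroup W] [Module F W] [Fintype (Module.Dual F W)]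
    (f : W → F) (Φ₀ Φ₁ : ℕ → A) : A :=
  ∑ l : Module.Dual F W, ∑ c : F,
    if c = 0 then Φ₀ (zeros fun x => f x + l x + c) else Φ₁ (zeros fun x => f x + l x + c)

lemma sum_ite_eq_zero (a b : A) :
    (∑ c : F, if c = 0 then a else b) = a + ((Fintype.card F : ℚ) - 1) • b := by
  rw [← Finset.add_sum_erase _ _ (Finset.mem_univ (0 : F)), if_pos rfl,
    Finset.sum_congr rfl (g := fun _ => b) (fun c hc => if_neg (Finset.ne_of_mem_erase hc)),
    Finset.sum_const, Finset.card_erase_of_mem (Finset.mem_univ _), Finset.card_univ,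
    ← Nat.cast_smul_eq_nsmul ℚ, Nat.cast_pred Fintype.card_pos]

variable {V W : Type*} [AddCommGroup V] [Module F V] [AddCommGroup W] [Module F W]

lemma affineSum_comp_equiv [Fintype (Module.Dual F V)] [Fintype (Module.Dual F W)] (e : V ≃ₗ[F] W)
    (f : W → F) (Φ₀ Φ₁ : ℕ → A) :
    affineSum (fun x => f (e x)) Φ₀ Φ₁ = affineSum f Φ₀ Φ₁ := by
  unfold affineSum
  refine (Fintype.sum_equiv e.dualMap.toEquiv _ _ fun l => ?_).symm
  refine Finset.sum_congr rfl fun c _ => ?_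
  have := zeros_comp_equiv e.toEquiv (fun x => f x + l x + c)
  simp only [LinearEquiv.coe_toEquiv] at this ⊢
  simp only [LinearEquiv.dualMap_apply, this]

lemma card_dual (K : Type*) [AddCommGroup K] [Module F K] [Finite K]
    [Fintype (Module.Dual F K)] :
    Fintype.card (Module.Dual F K) = Nat.card K := by
  have : Module.Finite F K := Module.Finite.of_finite
  rw [Module.card_eq_pow_finrank (K := F) (V := Module.Dual F K),
    Module.natCard_eq_pow_finrank (K := F) (V := K), Subspace.dual_finrank_eq, Nat.card_eq_fintype_card]

/-- The affine sum of a function that does not depend on the coordinates in a direct summand `K`.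
The affine functions that vary along `K` only see the average. -/
lemma affineSum_prod_radical {Z K : Type*} [AddCommGroup Z] [Module F Z] [AddCommGroup K]
    [Module F K] [Finite Z] [Finite K] [Fintype (Module.Dual F Z)]
    [Fintype (Module.Dual F (Z × K))] (f : Z → F) (Φ₀ Φ₁ : ℕ → A) (B : ℕ)
    (hB : Nat.card Z * Nat.card K = Fintype.card F * B) :
    affineSum (fun p : Z × K => f p.1) Φ₀ Φ₁
      = affineSum f (fun n => Φ₀ (n * Nat.card K)) (fun n => Φ₁ (n * Nat.card K))
        + ((Nat.card Z : ℚ) * (Nat.card K - 1)) •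
          (Φ₀ B + ((Fintype.card F : ℚ) - 1) • Φ₁ B) := by
  classical
  have : Module.Finite F K := Module.Finite.of_finite
  have : Finite (Module.Dual F K) := Module.finite_of_finite F
  let _ : Fintype (Module.Dual F K) := Fintype.ofFinite _
  have hz0 (l : Module.Dual F Z) (c : F) :
      zeros (fun p : Z × K => f p.1 + (l p.1 + (0 : Module.Dual F K) p.2) + c)
        = zeros (fun z => f z + l z + c) * Nat.card K := by
    unfold zeros
    rw [← Set.ncard_univ, ← Set.ncard_prod]
    congr 1
    ext; simp
  have hz1 (l : Module.Dual F Z) {k : Module.Dual F K} (hk : k ≠ 0) (c : F) :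
      zeros (fun p : Z × K => f p.1 + (l p.1 + k p.2) + c) = B := by
    obtain ⟨v, hv⟩ : ∃ v, k v ≠ 0 := by
      by_contra! h
      exact hk (LinearMap.ext h)
    have := card_mul_ncard_fiber (fun p : Z × K => f p.1 + (l p.1 + k p.2) + c)
      (0, (k v)⁻¹ • v) (fun x a => by simp [hv]; ring) 0
    rw [Nat.card_prod, hB, Nat.card_eq_fintype_card] at this
    exact Nat.eq_of_mul_eq_mul_left Fintype.card_pos this
  unfold affineSum
  rw [← (LinearMap.coprodEquiv F (M := Z) (M₂ := K) (M₃ := F)).toEquiv.sum_comp,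
    Fintype.sum_prod_type]
  simp only [LinearEquiv.coe_toEquiv, LinearMap.coprodEquiv_apply, LinearMap.coprod_apply]
  rw [← card_dual (F := F) Z, mul_smul, Nat.cast_smul_eq_nsmul, Fintype.card,
    ← Finset.sum_const, ← Finset.sum_add_distrib]
  refine Finset.sum_congr rfl fun l _ => ?_
  rw [← Finset.add_sum_erase _ _ (Finset.mem_univ (0 : Module.Dual F K))]
  simp only [hz0]
  congr 1
  rw [Finset.sum_congr rfl (g := fun _ => Φ₀ B + ((Fintype.card F : ℚ) - 1) • Φ₁ B),
    Finset.sum_const, Finset.card_erase_of_mem (Finset.mem_univ _), Finset.card_univ,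
    ← Nat.cast_smul_eq_nsmul ℚ, Nat.cast_pred Fintype.card_pos, card_dual (F := F) K]
  intro k hk
  simp only [hz1 l (Finset.ne_of_mem_erase hk)]
  exact sum_ite_eq_zero _ _

/-- The number of solutions of `∑ xᵢ yᵢ = t` in `2 s` variables, for `t ≠ 0`. For `s = 0` the
truncated exponent does not matter, as the first factor vanishes. -/
def hyperbolicCount (q s : ℕ) : ℕ := (q ^ s - 1) * q ^ (s - 1)

lemma cast_hyperbolicCount {q : ℕ} (hq : 1 ≤ q) (s : ℕ) :
    (hyperbolicCount q s : ℚ) = (q : ℚ) ^ s * ((q : ℚ) ^ s - 1) / q := by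
  have : (q : ℚ) ≠ 0 := by positivity
  unfold hyperbolicCount
  rcases s with _ | s
  · simp
  · rw [Nat.cast_mul, Nat.cast_sub (Nat.one_le_pow _ _ hq)]
    push_cast
    field_simp
    ring

/-- The number of solutions of `∑ xᵢ yᵢ = t` in `2 s` variables. -/
lemma ncard_dotProduct_eq (s : ℕ) (t : F) :
    {p : (Fin s → F) × (Fin s → F) | p.1 ⬝ᵥ p.2 = t}.ncard
      = hyperbolicCount (Fintype.card F) s + if t = 0 then Fintype.card F ^ s else 0 := by
  classical
  have h1 (a : Fin s → F) : {b | a ⬝ᵥ b = t}.ncard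
      = if a = 0 then (if t = 0 then Fintype.card F ^ s else 0)
        else Fintype.card F ^ (s - 1) := by
    split_ifs with ha ht
    · subst ha ht
      simp [Set.ncard_univ]
    · subst ha
      simp [Ne.symm ht]
    · have hs : s ≠ 0 := by
        rintro rfl
        exact ha (Subsingleton.elim _ _)
      have hl : dotProductBilin F F a ≠ (0 : (Fin s → F) →ₗ[F] F) := by
        intro h
        refine ha (funext fun i => ?_)
        simpa using LinearMap.congr_fun h (Pi.single i 1)
      have := card_mul_ncard_linear_fiber hl t
      simp only [Nat.card_eq_fintype_card, Fintype.card_pi, Finset.prod_const, Finset.card_univ,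
        Fintype.card_fin] at this
      obtain ⟨s, rfl⟩ := Nat.exists_eq_succ_of_ne_zero hs
      rw [pow_succ'] at this
      exact Nat.eq_of_mul_eq_mul_left Fintype.card_pos this
  have h2 : {p : (Fin s → F) × (Fin s → F) | p.1 ⬝ᵥ p.2 = t}.ncard
      = ∑ a : Fin s → F, {b | a ⬝ᵥ b = t}.ncard := by
    rw [ncard_setOf_eq_sum, Fintype.sum_prod_type]
    exact Finset.sum_congr rfl fun a _ => (ncard_setOf_eq_sum _).symm
  rw [h2, Finset.sum_congr rfl (fun a _ => h1 a),
    ← Finset.add_sum_erase _ _ (Finset.mem_univ (0 : Fin s → F)), if_pos rfl,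
    Finset.sum_congr rfl (g := fun _ => Fintype.card F ^ (s - 1))
      (fun c hc => if_neg (Finset.ne_of_mem_erase hc)),
    Finset.sum_const, Finset.card_erase_of_mem (Finset.mem_univ _), add_comm]
  simp [hyperbolicCount]

/-- The number of zeros of `∑ xᵢ yᵢ + g`, where `g` depends on other variables. -/
lemma zeros_dotProduct_add {Z : Type*} [Finite Z] (s : ℕ) (g : Z → F) :
    zeros (fun p : ((Fin s → F) × (Fin s → F)) × Z => p.1.1 ⬝ᵥ p.1.2 + g p.2)
      = Nat.card Z * hyperbolicCount (Fintype.card F) s + Fintype.card F ^ s * zeros g := by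
  classical
  have := Fintype.ofFinite Z
  have h (z : Z) : (∑ p : (Fin s → F) × (Fin s → F), if p.1 ⬝ᵥ p.2 + g z = 0 then 1 else 0)
      = hyperbolicCount (Fintype.card F) s + Fintype.card F ^ s * if g z = 0 then 1 else 0 := by
    rw [← ncard_setOf_eq_sum]
    simp only [add_eq_zero_iff_eq_neg, ncard_dotProduct_eq, neg_eq_zero, mul_ite, mul_one, mul_zero]
  rw [zeros, ncard_setOf_eq_sum, Fintype.sum_prod_type, Finset.sum_comm]
  dsimp only
  rw [Finset.sum_congr rfl (fun z _ => h z), Finset.sum_add_distrib, ← Finset.mul_sum, zeros,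
    ncard_setOf_eq_sum]
  simp

/-- Adding hyperbolic planes transforms the affine sum linearly: completing the form by a
translation moves the linear part on the hyperbolic planes into the constant term. -/
lemma affineSum_dotProduct_add {Z : Type*} [AddCommGroup Z] [Module F Z] [Finite Z] (s : ℕ)
    [Fintype (Module.Dual F Z)] [Fintype (Module.Dual F (((Fin s → F) × (Fin s → F)) × Z))]
    (f : Z → F) (Φ₀ Φ₁ : ℕ → A) (h M : ℕ → ℕ)
    (hh : ∀ i, h i = hyperbolicCount (Fintype.card F) s + if i = 0 then Fintype.card F ^ s else 0)
    (hM : ∀ n, M n = Nat.card Z * hyperbolicCount (Fintype.card F) s + Fintype.card F ^ s * n) :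
    affineSum (fun p : ((Fin s → F) × (Fin s → F)) × Z => p.1.1 ⬝ᵥ p.1.2 + f p.2) Φ₀ Φ₁
      = affineSum f
          (fun n => (h 0 : ℚ) • Φ₀ (M n)
            + ((Fintype.card F : ℚ) ^ (2 * s) - h 0) • Φ₁ (M n))
          (fun n => (h 1 : ℚ) • Φ₀ (M n)
            + ((Fintype.card F : ℚ) ^ (2 * s) - h 1) • Φ₁ (M n)) := by
  classical
  let E : (((Fin s → F) × (Fin s → F)) × Module.Dual F Z)
      ≃ Module.Dual F (((Fin s → F) × (Fin s → F)) × Z) :=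
    (((dotProductEquiv F (Fin s)).prodCongr (dotProductEquiv F (Fin s)) ≪≫ₗ
      LinearMap.coprodEquiv F).prodCongr (LinearEquiv.refl F (Module.Dual F Z)) ≪≫ₗ
      LinearMap.coprodEquiv F).toEquiv
  have hE (u v : Fin s → F) (l : Module.Dual F Z) (a b : Fin s → F) (z : Z) :
      E ((u, v), l) ((a, b), z) = u ⬝ᵥ a + v ⬝ᵥ b + l z := by
    simp [E, dotProductEquiv]
  have hz (u v : Fin s → F) (l : Module.Dual F Z) (c : F) :
      zeros (fun p : ((Fin s → F) × (Fin s → F)) × Z =>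
        p.1.1 ⬝ᵥ p.1.2 + f p.2 + E ((u, v), l) p + (c + u ⬝ᵥ v))
      = M (zeros fun z => f z + l z + c) := by
    rw [hM, ← zeros_dotProduct_add]
    have := zeros_comp_equiv (((Equiv.addRight v).prodCongr (Equiv.addRight u)).prodCongr
      (Equiv.refl Z)) (fun p => p.1.1 ⬝ᵥ p.1.2 + (f p.2 + l p.2 + c))
    rw [← this]
    congr 1
    ext ⟨⟨a, b⟩, z⟩
    simp only [hE, Equiv.prodCongr_apply, Prod.map, Equiv.coe_addRight, Equiv.refl_apply,
      add_dotProduct, dotProduct_add, dotProduct_comm u a, dotProduct_comm u v]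
    ring
  unfold affineSum
  rw [← E.sum_comp, Fintype.sum_prod_type, Finset.sum_comm]
  refine Finset.sum_congr rfl fun l _ => ?_
  have hc (p : (Fin s → F) × (Fin s → F)) (g : F → A) :
      ∑ c, g c = ∑ c, g (c + p.1 ⬝ᵥ p.2) :=
    (Equiv.sum_comp (Equiv.addRight (p.1 ⬝ᵥ p.2)) g).symm
  rw [Finset.sum_congr rfl (fun p _ => hc p _), Finset.sum_comm]
  refine Finset.sum_congr rfl fun c _ => ?_
  simp only [hz]
  have hcount (X Y : A) : (∑ p : (Fin s → F) × (Fin s → F), if c + p.1 ⬝ᵥ p.2 = 0 then X else Y)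
      = ({p : (Fin s → F) × (Fin s → F) | p.1 ⬝ᵥ p.2 = -c}.ncard : ℚ) • X
        + ((Fintype.card F : ℚ) ^ (2 * s)
          - {p : (Fin s → F) × (Fin s → F) | p.1 ⬝ᵥ p.2 = -c}.ncard) • Y := by
    have h1 (p : (Fin s → F) × (Fin s → F)) : (if c + p.1 ⬝ᵥ p.2 = 0 then X else Y)
        = Y + (if p.1 ⬝ᵥ p.2 = -c then (1 : ℕ) else 0) • (X - Y) := by
      have : c + p.1 ⬝ᵥ p.2 = 0 ↔ p.1 ⬝ᵥ p.2 = -c := by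
        rw [add_comm, add_eq_zero_iff_eq_neg]
      simp only [this]
      split_ifs <;> simp
    rw [Finset.sum_congr rfl (fun p _ => h1 p), Finset.sum_add_distrib, ← Finset.sum_smul,
      ncard_setOf_eq_sum]
    simp only [Finset.sum_const, Finset.card_univ, Fintype.card_prod, Fintype.card_pi,
      Finset.prod_const, Fintype.card_fin, ← Nat.cast_smul_eq_nsmul ℚ]
    push_cast
    module
  rw [hcount, ncard_dotProduct_eq, hh, hh]
  by_cases hc0 : c = 0 <;> simp [hc0]

/-- The affine sum of the form in no variables. -/
lemma affineSum_of_subsingleton {Z : Type*} [AddCommGroup Z] [Module F Z] [Subsingleton Z]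
    [Fintype (Module.Dual F Z)] (f : Z → F) (hf : f 0 = 0) (Φ₀ Φ₁ : ℕ → A) :
    affineSum f Φ₀ Φ₁ = Φ₀ 1 + ((Fintype.card F : ℚ) - 1) • Φ₁ 0 := by
  have hz (c : F) : zeros (fun x => f x + (0 : Module.Dual F Z) x + c) = if c = 0 then 1 else 0 := by
    have h (x : Z) : f x = 0 := by rw [Subsingleton.elim x 0, hf]
    have : Unique Z := ⟨⟨0⟩, fun x => Subsingleton.elim x 0⟩
    unfold zeros
    split_ifs with hc <;> simp [h, hc, Set.ncard_univ]
  unfold affineSum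
  rw [Fintype.sum_subsingleton _ (0 : Module.Dual F Z), ← sum_ite_eq_zero]
  refine Finset.sum_congr rfl fun c _ => ?_
  simp only [hz]
  split_ifs <;> rfl

end AffineSum

/-! ### Anisotropic forms in one and two variables -/

section BaseCases

variable {F : Type*} [Field F] [Fintype F] [DecidableEq F]
variable {A : Type*} [AddCommGroup A] [Module ℚ A]

/-- A sum over values in `{0, 1, 2}` is determined by the first two moments, by interpolation. -/
lemma sum_of_le_two {ι : Type*} [Fintype ι] (n : ι → ℕ) (hn : ∀ i, n i ≤ 2) (Φ : ℕ → A) :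
    ∑ i, Φ (n i) = (Fintype.card ι : ℚ) • Φ 0 + ((∑ i, n i : ℕ) : ℚ) • (Φ 1 - Φ 0)
      + ((((∑ i, n i ^ 2 : ℕ) : ℚ) - (∑ i, n i : ℕ)) / 2) • (Φ 2 - (2 : ℚ) • Φ 1 + Φ 0) := by
  have h (i : ι) : Φ (n i) = (1 : ℚ) • Φ 0 + (n i : ℚ) • (Φ 1 - Φ 0)
      + (((n i : ℚ) ^ 2 - n i) / 2) • (Φ 2 - (2 : ℚ) • Φ 1 + Φ 0) := by
    have := hn i
    interval_cases n i
    · module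
    · module
    · module
  rw [Finset.sum_congr rfl (fun i _ => h i), Finset.sum_add_distrib, Finset.sum_add_distrib,
    ← Finset.sum_smul, ← Finset.sum_smul, ← Finset.sum_smul, ← Finset.sum_div,
    Finset.sum_sub_distrib]
  push_cast
  simp

lemma zeros_quadratic_le_two {a : F} (ha : a ≠ 0) (e c : F) :
    zeros (fun t : F => a * t ^ 2 + e * t + c) ≤ 2 := by
  by_contra! h
  obtain ⟨x, y, z, hx, hy, hz, hxy, hxz, hyz⟩ := (Set.two_lt_ncard_iff (Set.toFinite _)).1 h
  simp only [Set.mem_ofPred_eq] at hx hy hz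
  have h1 : a * (x + y) + e = 0 := by
    refine (mul_eq_zero.1 ?_).resolve_left (sub_ne_zero.2 hxy)
    linear_combination hx - hy
  have h2 : a * (x + z) + e = 0 := by
    refine (mul_eq_zero.1 ?_).resolve_left (sub_ne_zero.2 hxz)
    linear_combination hx - hz
  refine (mul_ne_zero ha (sub_ne_zero.2 hyz)) ?_
  linear_combination h1 - h2

lemma sum_zeros_quadratic (a : F) :
    ∑ p : F × F, zeros (fun t : F => a * t ^ 2 + p.1 * t + p.2) = Fintype.card F ^ 2 := by
  simp only [zeros, ncard_setOf_eq_sum]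
  rw [Finset.sum_comm]
  have h (t : F) : (∑ p : F × F, if a * t ^ 2 + p.1 * t + p.2 = 0 then 1 else 0)
      = Fintype.card F := by
    rw [Fintype.sum_prod_type]
    simp only [add_eq_zero_iff_neg_eq]
    simp
  rw [Finset.sum_congr rfl (fun t _ => h t)]
  simp [sq]

/-- The second moment counts the quadratic polynomials with two prescribed roots. -/
lemma sum_zeros_quadratic_sq (a : F) :
    ∑ p : F × F, zeros (fun t : F => a * t ^ 2 + p.1 * t + p.2) ^ 2
      = Fintype.card F ^ 2 + Fintype.card F * (Fintype.card F - 1) := by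
  simp only [zeros, ncard_setOf_eq_sum, sq, Finset.sum_mul_sum]
  rw [Finset.sum_comm]
  have h (t u : F) : (∑ p : F × F, (if a * (t * t) + p.1 * t + p.2 = 0 then 1 else 0)
      * (if a * (u * u) + p.1 * u + p.2 = 0 then 1 else 0))
      = if t = u then Fintype.card F else 1 := by
    rw [Fintype.sum_prod_type]
    simp only [add_eq_zero_iff_neg_eq, ite_mul, one_mul, zero_mul]
    simp only [Finset.sum_ite_eq, Finset.mem_univ, if_true]
    split_ifs with htu
    · subst htu
      simp
    · have h2 (e : F) : -(a * (u * u) + e * u) = -(a * (t * t) + e * t) ↔ e = -(a * (t + u)) := by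
        constructor
        · intro h
          apply mul_left_cancel₀ (sub_ne_zero.2 htu)
          linear_combination h
        · rintro rfl
          ring
      simp only [h2]
      simp
  have h3 (t : F) : (∑ u : F, ∑ p : F × F, (if a * (t * t) + p.1 * t + p.2 = 0 then 1 else 0)
      * (if a * (u * u) + p.1 * u + p.2 = 0 then 1 else 0))
      = Fintype.card F + (Fintype.card F - 1) := by
    simp only [h]
    rw [← Finset.add_sum_erase _ _ (Finset.mem_univ t), if_pos rfl,
      Finset.sum_congr rfl (g := fun _ => 1)
        (fun c hc => if_neg (Finset.ne_of_mem_erase hc).symm)]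
    simp
  rw [Finset.sum_congr rfl (fun t _ => Finset.sum_comm.trans (h3 t))]
  simp [mul_add]

/-- The affine sum of a nonzero form in one variable. -/
lemma affineSum_one {Z : Type*} [AddCommGroup Z] [Module F Z] [Fintype (Module.Dual F Z)]
    (T : F ≃ₗ[F] Z) (R : QuadraticForm F Z) (hR : R.Anisotropic) (Φ₀ Φ₁ : ℕ → A) :
    affineSum R Φ₀ Φ₁ = Φ₀ 1 + ((Fintype.card F : ℚ) - 1) • Φ₀ 2
      + ((Fintype.card F : ℚ) - 1) • Φ₁ 1
      + (((Fintype.card F : ℚ) - 1) * (Fintype.card F - 2) / 2) • Φ₁ 2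
      + ((Fintype.card F : ℚ) * (Fintype.card F - 1) / 2) • Φ₁ 0 := by
  have : Finite (Module.Dual F F) := Module.finite_of_finite F
  let _ : Fintype (Module.Dual F F) := Fintype.ofFinite _
  set a := R (T 1) with ha_def
  have ha : a ≠ 0 := fun h => one_ne_zero (T.map_eq_zero_iff.1 (hR _ h))
  have hRT (t : F) : R (T t) = a * t ^ 2 := by
    have : T t = t • T 1 := by rw [← map_smul, smul_eq_mul, mul_one]
    rw [this, QuadraticMap.map_smul, smul_eq_mul]
    ring
  rw [← affineSum_comp_equiv T]
  simp only [hRT]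
  unfold affineSum
  rw [← (LinearMap.ringLmapEquivSelf F F F).symm.toEquiv.sum_comp]
  set n : F × F → ℕ := fun p => zeros (fun t : F => a * t ^ 2 + p.1 * t + p.2) with hn_def
  have h1 (e c : F) : zeros (fun t : F => a * t ^ 2
      + (LinearMap.ringLmapEquivSelf F F F).symm.toEquiv e t + c) = n (e, c) := by
    simp [hn_def, mul_comm]
  simp only [h1]
  have h2 (e : F) : (∑ c : F, if c = 0 then Φ₀ (n (e, c)) else Φ₁ (n (e, c)))
      = Φ₀ (n (e, 0)) - Φ₁ (n (e, 0)) + ∑ c, Φ₁ (n (e, c)) := by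
    rw [← Finset.add_sum_erase _ _ (Finset.mem_univ (0 : F)),
      ← Finset.add_sum_erase Finset.univ (fun c => Φ₁ (n (e, c))) (Finset.mem_univ (0 : F)),
      if_pos rfl, Finset.sum_congr rfl (fun c hc => if_neg (Finset.ne_of_mem_erase hc))]
    abel
  have h3 (e : F) : n (e, 0) = if e = 0 then 1 else 2 := by
    simp only [hn_def, zeros, add_zero]
    split_ifs with he
    · simp [he, ha]
    · have : {t : F | a * t ^ 2 + e * t = 0} = {0, -e / a} := by
        ext t
        have h5 : a * t ^ 2 + e * t = t * (a * t + e) := by ring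
        simp only [Set.mem_ofPred_eq, h5, mul_eq_zero, Set.mem_insert_iff,
          Set.mem_singleton_iff, eq_div_iff ha]
        rw [add_eq_zero_iff_eq_neg, mul_comm t a]
      rw [this, Set.ncard_pair]
      exact (div_ne_zero (neg_ne_zero.2 he) ha).symm
  rw [Finset.sum_congr rfl (fun e _ => h2 e), Finset.sum_add_distrib, ← Fintype.sum_prod_type',
    sum_of_le_two n (fun p => zeros_quadratic_le_two ha p.1 p.2), sum_zeros_quadratic,
    sum_zeros_quadratic_sq a]
  have h4 (e : F) : Φ₀ (n (e, 0)) - Φ₁ (n (e, 0)) = if e = 0 then Φ₀ 1 - Φ₁ 1 else Φ₀ 2 - Φ₁ 2 := by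
    rw [h3]
    split_ifs <;> rfl
  rw [Finset.sum_congr rfl (fun e _ => h4 e), sum_ite_eq_zero, Fintype.card_prod]
  push_cast [Nat.cast_pred (Fintype.card_pos (α := F))]
  module

/-- On an anisotropic plane the polar form is nondegenerate. -/
lemma exists_polar_ne_zero {Z : Type*} [AddCommGroup Z] [Module F Z]
    (hZ : Module.finrank F Z = 2) (R : QuadraticForm F Z) (hR : R.Anisotropic) {d : Z}
    (hd : d ≠ 0) : ∃ y, QuadraticMap.polar R d y ≠ 0 := by
  by_contra! h
  by_cases h2 : ringChar F = 2
  · have : Module.Finite F Z := Module.finite_of_finrank_eq_succ hZ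
    have : CharP F 2 := by rw [← h2]; exact ringChar.charP F
    obtain ⟨y, hy⟩ : ∃ y, y ∉ Submodule.span F {d} := by
      by_contra! hy
      have h1 := finrank_span_singleton (K := F) hd
      rw [Submodule.eq_top_iff'.2 hy, finrank_top, hZ] at h1
      omega
    -- a scalar `t` with `R (t • d) = R y`, so that `t • d + y` is singular
    obtain ⟨t, ht⟩ := FiniteField.isSquare_of_char_two h2 (R y / R d)
    have hRd : R d ≠ 0 := fun h => hd (hR _ h)
    rw [div_eq_iff hRd] at ht
    have h0 : R (t • d + y) = 0 := by
      rw [QuadraticMap.map_add R, QuadraticMap.map_smul, QuadraticMap.polar_smul_left, h, ht]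
      simp [CharTwo.add_self_eq_zero]
    apply hy
    rw [eq_neg_of_add_eq_zero_right (hR _ h0)]
    exact neg_mem (Submodule.smul_mem _ _ (Submodule.mem_span_singleton_self d))
  · have h1 := h d
    rw [QuadraticMap.polar_self] at h1
    have h3 : (2 : F) ≠ 0 := Ring.two_ne_zero h2
    rcases mul_eq_zero.1 (by simpa [two_smul, two_mul] using h1 : (2 : F) * R d = 0) with h | h
    · exact h3 h
    · exact hd (hR _ h)

/-- An anisotropic form on a plane represents every nonzero value equally often: the first two
moments of the distribution of its values have the extremal ratio. -/
lemma ncard_anisotropic_eq {Z : Type*} [AddCommGroup Z] [Module F Z]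
    (hZ : Module.finrank F Z = 2) (R : QuadraticForm F Z) (hR : R.Anisotropic) (t : F) :
    {z | R z = t}.ncard = if t = 0 then 1 else Fintype.card F + 1 := by
  have : Module.Finite F Z := Module.finite_of_finrank_eq_succ hZ
  have : Finite Z := Module.finite_of_finite F
  classical
  have := Fintype.ofFinite Z
  have hcard : Fintype.card Z = Fintype.card F ^ 2 := by
    rw [Module.card_eq_pow_finrank (K := F), hZ]
  set q := Fintype.card F with hq
  have hq0 : 0 < q := Fintype.card_pos
  set n : F → ℕ := fun t => {z | R z = t}.ncard with hn
  have hn0 : n 0 = 1 := by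
    have : {z | R z = 0} = {0} := by
      ext z
      exact ⟨fun h => hR _ h, by rintro rfl; simp⟩
    simp [hn, this]
  have h1 : ∑ t, n t = q ^ 2 := by
    simp only [hn, ncard_setOf_eq_sum]
    rw [Finset.sum_comm]
    simp [hcard]
  have h2 : ∑ t, n t ^ 2 = q ^ 2 + (q ^ 2 - 1) * q := by
    -- count the pairs of vectors with equal values by their difference `d`
    have h3 : ∑ t, n t ^ 2 = ∑ d : Z, {y | R (d + y) = R y}.ncard := by
      simp only [hn, ncard_setOf_eq_sum, sq, Finset.sum_mul_sum]
      have h4 (x y : Z) : (∑ t, (if R x = t then 1 else 0) * (if R y = t then 1 else 0))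
          = if R x = R y then 1 else 0 := by
        simp only [ite_mul, one_mul, zero_mul, Finset.sum_ite_eq, Finset.mem_univ, if_true,
          eq_comm (a := R y)]
      rw [Finset.sum_comm, Finset.sum_congr rfl (fun _ _ => Finset.sum_comm)]
      simp only [h4]
      rw [Finset.sum_comm]
      conv_rhs => rw [Finset.sum_comm]
      exact Finset.sum_congr rfl fun y _ =>
        (Equiv.sum_comp (Equiv.addRight y) fun x => if R x = R y then 1 else 0).symm
    have h4 (d : Z) (hd : d ≠ 0) : {y | R (d + y) = R y}.ncard = q := by
      have hl : R.polarBilin d ≠ 0 := by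
        obtain ⟨y, hy⟩ := exists_polar_ne_zero hZ R hR hd
        exact fun h => hy (by simpa using LinearMap.congr_fun h y)
      have := card_mul_ncard_linear_fiber hl (-R d)
      have h5 : {y | R (d + y) = R y} = {y | R.polarBilin d y = -R d} := by
        ext y
        simp only [Set.mem_ofPred_eq, QuadraticMap.polarBilin_apply_apply, QuadraticMap.map_add R d y]
        constructor
        · intro h; linear_combination h
        · intro h; linear_combination h
      rw [h5]
      rw [Nat.card_eq_fintype_card, Nat.card_eq_fintype_card, hcard, sq] at this
      exact Nat.eq_of_mul_eq_mul_left hq0 this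
    rw [h3, ← Finset.add_sum_erase _ _ (Finset.mem_univ (0 : Z)),
      Finset.sum_congr rfl (fun d hd => h4 d (Finset.ne_of_mem_erase hd))]
    simp [Set.ncard_univ, hcard]
  -- the variance of the number of representations of nonzero scalars is zero
  have h3 : ∑ t ∈ Finset.univ.erase (0 : F), ((n t : ℚ) - (q + 1)) ^ 2 = 0 := by
    have e1 : ∑ t ∈ Finset.univ.erase (0 : F), (n t : ℚ) = q ^ 2 - 1 := by
      have : (∑ t, (n t : ℚ)) = q ^ 2 := by exact_mod_cast h1
      rw [← this, ← Finset.add_sum_erase _ _ (Finset.mem_univ (0 : F)), hn0]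
      push_cast; ring
    have e2 : ∑ t ∈ Finset.univ.erase (0 : F), (n t : ℚ) ^ 2 = q ^ 2 + (q ^ 2 - 1) * q - 1 := by
      have : (∑ t, (n t : ℚ) ^ 2) = q ^ 2 + (q ^ 2 - 1) * q := by
        have h5 : 1 ≤ q ^ 2 := Nat.one_le_pow _ _ hq0
        have := congrArg (Nat.cast (R := ℚ)) h2
        push_cast [Nat.cast_sub h5] at this
        exact this
      rw [← this, ← Finset.add_sum_erase _ _ (Finset.mem_univ (0 : F)), hn0]
      push_cast; ring
    have e3 : ((Finset.univ.erase (0 : F)).card : ℚ) = q - 1 := by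
      rw [Finset.card_erase_of_mem (Finset.mem_univ _), Finset.card_univ, Nat.cast_pred hq0]
    simp only [sub_sq, Finset.sum_add_distrib, Finset.sum_sub_distrib, ← Finset.sum_mul,
      ← Finset.mul_sum, e1, e2, Finset.sum_const, nsmul_eq_mul, e3]
    ring
  split_ifs with ht
  · rw [ht]; exact hn0
  · have := (Finset.sum_eq_zero_iff_of_nonneg (fun t _ => sq_nonneg _)).1 h3 t
      (Finset.mem_erase.2 ⟨ht, Finset.mem_univ _⟩)
    have := pow_eq_zero_iff two_ne_zero |>.1 this
    have : (n t : ℚ) = ((q + 1 : ℕ) : ℚ) := by push_cast; linarith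
    exact_mod_cast this

/-- The affine sum of an anisotropic form on a plane. Every linear function is the linear part of
a translate of the form. -/
lemma affineSum_two {Z : Type*} [AddCommGroup Z] [Module F Z] [Fintype (Module.Dual F Z)]
    (hZ : Module.finrank F Z = 2) (R : QuadraticForm F Z) (hR : R.Anisotropic) (Φ₀ Φ₁ : ℕ → A) :
    affineSum R Φ₀ Φ₁ = Φ₀ 1 + ((Fintype.card F : ℚ) ^ 2 - 1) • Φ₀ (Fintype.card F + 1)
      + ((Fintype.card F : ℚ) ^ 2 - 1) • Φ₁ 1
      + (((Fintype.card F : ℚ) - 1) * ((Fintype.card F : ℚ) ^ 2 - Fintype.card F - 1)) •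
        Φ₁ (Fintype.card F + 1) := by
  have : Module.Finite F Z := Module.finite_of_finrank_eq_succ hZ
  have : Finite Z := Module.finite_of_finite F
  classical
  have := Fintype.ofFinite Z
  have hcard : Fintype.card Z = Fintype.card F ^ 2 := by
    rw [Module.card_eq_pow_finrank (K := F), hZ]
  set q := Fintype.card F with hq
  let E : Z ≃ₗ[F] Module.Dual F Z := LinearMap.linearEquivOfInjective R.polarBilin
    (by
      rw [injective_iff_map_eq_zero]
      intro d hd
      by_contra h0
      obtain ⟨y, hy⟩ := exists_polar_ne_zero hZ R hR h0
      exact hy (by simpa using LinearMap.congr_fun hd y))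
    (Subspace.dual_finrank_eq).symm
  have hE (u x : Z) : E u x = QuadraticMap.polar R u x := rfl
  have hz (u : Z) (c : F) : zeros (fun x => R x + E u x + c) = if R u = c then 1 else q + 1 := by
    have h1 := zeros_comp_equiv (Equiv.addRight u) (fun x => R x + (c - R u))
    have h2 : zeros (fun x => R x + (c - R u)) = if R u - c = 0 then 1 else q + 1 := by
      rw [← ncard_anisotropic_eq hZ R hR, zeros]
      simp only [add_eq_zero_iff_eq_neg, neg_sub]
    simp only [sub_eq_zero] at h2
    rw [← h2, ← h1]
    congr 1
    ext x
    simp only [Equiv.coe_addRight, hE, QuadraticMap.map_add R x u, QuadraticMap.polar_comm R u x]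
    ring
  unfold affineSum
  rw [← E.toEquiv.sum_comp, Finset.sum_comm]
  simp only [LinearEquiv.coe_toEquiv, hz]
  have hcount (c : F) (X Y : A) : (∑ u : Z, if R u = c then X else Y)
      = ({u | R u = c}.ncard : ℚ) • X + ((q : ℚ) ^ 2 - {u | R u = c}.ncard) • Y := by
    have h1 (u : Z) : (if R u = c then X else Y)
        = Y + (if R u = c then (1 : ℕ) else 0) • (X - Y) := by
      split_ifs <;> simp
    rw [Finset.sum_congr rfl (fun p _ => h1 p), Finset.sum_add_distrib, ← Finset.sum_smul,
      ncard_setOf_eq_sum]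
    simp only [Finset.sum_const, Finset.card_univ, hcard, ← Nat.cast_smul_eq_nsmul ℚ]
    push_cast
    module
  have hc (c : F) : (∑ u : Z, if c = 0 then Φ₀ (if R u = c then 1 else q + 1)
        else Φ₁ (if R u = c then 1 else q + 1))
      = if c = 0 then Φ₀ 1 + ((q : ℚ) ^ 2 - 1) • Φ₀ (q + 1)
        else ((q : ℚ) + 1) • Φ₁ 1 + ((q : ℚ) ^ 2 - (q + 1)) • Φ₁ (q + 1) := by
    simp only [apply_ite Φ₀, apply_ite Φ₁]
    split_ifs with h0
    · rw [hcount, ncard_anisotropic_eq hZ R hR, if_pos h0]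
      simp
    · rw [hcount, ncard_anisotropic_eq hZ R hR, if_neg h0]
      push_cast
      rfl
  rw [Finset.sum_congr rfl (fun c _ => hc c), sum_ite_eq_zero]
  module

end BaseCases

/-! ### Decomposition of quadratic forms -/

section Classification

variable {F : Type*} [Field F] {V : Type*} [AddCommGroup V] [Module F V]

/-- `Q` is, in suitable coordinates, the orthogonal sum of `s` hyperbolic planes, the form `R` in
`r` variables, and the zero form in `k` variables. -/
def Decomposes (Q : QuadraticForm F V) (s r k : ℕ) (R : QuadraticForm F (Fin r → F)) : Prop :=
  ∃ e : V ≃ₗ[F] ((Fin s → F) × (Fin s → F)) × ((Fin r → F) × (Fin k → F)),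
    ∀ x, Q x = (e x).1.1 ⬝ᵥ (e x).1.2 + R (e x).2.1

/-- A singular vector outside the radical is part of a hyperbolic pair. -/
lemma exists_hyperbolic_pair {Q : QuadraticForm F V} {x : V} (hx : Q x = 0)
    (hr : x ∉ QuadraticMap.radical Q) : ∃ y, Q y = 0 ∧ QuadraticMap.polar Q x y = 1 := by
  obtain ⟨y, hy⟩ : ∃ y, QuadraticMap.polar Q x y ≠ 0 := by
    by_contra! h
    exact hr ⟨hx, LinearMap.ext fun y => by simpa using h y⟩
  obtain ⟨z, hz⟩ : ∃ z, QuadraticMap.polar Q x z = 1 :=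
    ⟨(QuadraticMap.polar Q x y)⁻¹ • y, by
      rw [QuadraticMap.polar_smul_right, smul_eq_mul, inv_mul_cancel₀ hy]⟩
  refine ⟨z + (-Q z) • x, ?_, ?_⟩
  · rw [QuadraticMap.map_add Q, QuadraticMap.map_smul, QuadraticMap.polar_smul_right,
      QuadraticMap.polar_comm, hz, hx]
    simp
  · rw [QuadraticMap.polar_add_right, QuadraticMap.polar_smul_right, hz, QuadraticMap.polar_self,
      hx]
    simp

/-- A form with a singular vector outside its radical splits off a hyperbolic plane. -/
lemma exists_split_plane [Module.Finite F V] {Q : QuadraticForm F V} {x : V} (hx : Q x = 0)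
    (hr : x ∉ QuadraticMap.radical Q) :
    ∃ (n : ℕ) (e : V ≃ₗ[F] (F × F) × (Fin n → F)) (R : QuadraticForm F (Fin n → F)),
      ∀ v, Q v = (e v).1.1 * (e v).1.2 + R (e v).2 := by
  obtain ⟨y, hy, hxy⟩ := exists_hyperbolic_pair hx hr
  have hyx : QuadraticMap.polar Q y x = 1 := by rw [QuadraticMap.polar_comm, hxy]
  have hxx : QuadraticMap.polar Q x x = 0 := by rw [QuadraticMap.polar_self, hx, smul_zero]
  have hyy : QuadraticMap.polar Q y y = 0 := by rw [QuadraticMap.polar_self, hy, smul_zero]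
  let C : Submodule F V := LinearMap.ker (Q.polarBilin x) ⊓ LinearMap.ker (Q.polarBilin y)
  have hCx (c : C) : QuadraticMap.polar Q x c = 0 := by simpa using c.2.1
  have hCy (c : C) : QuadraticMap.polar Q y c = 0 := by simpa using c.2.2
  let f : (F × F) × C →ₗ[F] V := ((LinearMap.toSpanSingleton F V x).coprod
    (LinearMap.toSpanSingleton F V y)).coprod C.subtype
  have hf (p : (F × F) × C) : f p = p.1.1 • x + p.1.2 • y + p.2 := by simp [f]
  have hQf (p : (F × F) × C) : Q (f p) = p.1.1 * p.1.2 + Q p.2 := by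
    simp only [hf, QuadraticMap.map_add Q, QuadraticMap.polar_add_left,
      QuadraticMap.polar_smul_left, QuadraticMap.polar_smul_right, QuadraticMap.map_smul, hx, hy,
      hCx, hCy, hxy]
    simp [mul_comm]
  have hb : Function.Bijective f := by
    constructor
    · rw [injective_iff_map_eq_zero]
      rintro ⟨⟨a, b⟩, c⟩ h
      rw [hf] at h
      have h1 := congrArg (Q.polarBilin x) h
      have h2 := congrArg (Q.polarBilin y) h
      simp [hxx, hyy, hxy, hyx, hCx, hCy] at h1 h2
      subst h1 h2
      simpa using h
    · intro v
      refine ⟨((QuadraticMap.polar Q y v, QuadraticMap.polar Q x v),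
        ⟨v - QuadraticMap.polar Q y v • x - QuadraticMap.polar Q x v • y, ?_, ?_⟩), ?_⟩
      · simp [QuadraticMap.polar_sub_right, hxx, hxy]
      · simp [QuadraticMap.polar_sub_right, hyx, hyy]
      · rw [hf]
        simp
  let E := LinearEquiv.ofBijective f hb
  let b := (Module.finBasis F C).equivFun
  refine ⟨_, E.symm ≪≫ₗ (LinearEquiv.refl F (F × F)).prodCongr b,
    (Q.comp C.subtype).comp b.symm.toLinearMap, fun v => ?_⟩
  obtain ⟨p, rfl⟩ := E.surjective v
  have h1 : Q (E p) = _ := hQf p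
  rw [h1]
  simp

variable [Finite F]

/-- By the Chevalley–Warning theorem, an anisotropic form has at most two variables. -/
lemma finrank_le_two_of_anisotropic [Module.Finite F V] (Q : QuadraticForm F V)
    (hQ : Q.Anisotropic) : Module.finrank F V ≤ 2 := by
  by_contra! h
  have := Fintype.ofFinite F
  classical
  obtain ⟨v, hv⟩ := exists_linearIndependent_of_le_finrank (R := F) (M := V) (n := 3) h
  let B := QuadraticMap.polar Q
  let p : MvPolynomial (Fin 3) F :=
    MvPolynomial.C (Q (v 0)) * MvPolynomial.X 0 * MvPolynomial.X 0
    + MvPolynomial.C (Q (v 1)) * MvPolynomial.X 1 * MvPolynomial.X 1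
    + MvPolynomial.C (Q (v 2)) * MvPolynomial.X 2 * MvPolynomial.X 2
    + MvPolynomial.C (B (v 0) (v 1)) * MvPolynomial.X 0 * MvPolynomial.X 1
    + MvPolynomial.C (B (v 0) (v 2)) * MvPolynomial.X 0 * MvPolynomial.X 2
    + MvPolynomial.C (B (v 1) (v 2)) * MvPolynomial.X 1 * MvPolynomial.X 2
  have hp (x : Fin 3 → F) : MvPolynomial.eval x p = Q (∑ i, x i • v i) := by
    simp only [p, B, Fin.sum_univ_three, map_add, map_mul, MvPolynomial.eval_C, MvPolynomial.eval_X,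
      QuadraticMap.map_add Q, QuadraticMap.polar_add_left,
      QuadraticMap.polar_smul_left, QuadraticMap.polar_smul_right, QuadraticMap.map_smul,
      smul_eq_mul]
    ring
  have hterm (a : F) (i j : Fin 3) : (MvPolynomial.C a * MvPolynomial.X i * MvPolynomial.X j :
      MvPolynomial (Fin 3) F).totalDegree ≤ 2 := by
    refine (MvPolynomial.totalDegree_mul _ _).trans ?_
    refine (Nat.add_le_add_right (MvPolynomial.totalDegree_mul _ _) _).trans ?_
    simp
  have hdeg : p.totalDegree < Fintype.card (Fin 3) := by
    rw [Fintype.card_fin, Nat.lt_succ_iff]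
    refine (MvPolynomial.totalDegree_add _ _).trans (max_le ?_ (hterm _ _ _))
    refine (MvPolynomial.totalDegree_add _ _).trans (max_le ?_ (hterm _ _ _))
    refine (MvPolynomial.totalDegree_add _ _).trans (max_le ?_ (hterm _ _ _))
    refine (MvPolynomial.totalDegree_add _ _).trans (max_le ?_ (hterm _ _ _))
    exact (MvPolynomial.totalDegree_add _ _).trans (max_le (hterm _ _ _) (hterm _ _ _))
  have hdvd := char_dvd_card_solutions (ringChar F) hdeg
  have hone : Fintype.card {x : Fin 3 → F // MvPolynomial.eval x p = 0} = 1 := by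
    rw [Fintype.card_eq_one_iff]
    refine ⟨⟨0, by rw [hp]; simp⟩, ?_⟩
    rintro ⟨x, hx⟩
    rw [hp] at hx
    ext i
    exact Fintype.linearIndependent_iff.1 hv x (hQ _ hx) i
  rw [hone, Nat.dvd_one] at hdvd
  exact CharP.ringChar_ne_one hdvd

omit [Finite F] in
lemma Decomposes.comp {W : Type*} [AddCommGroup W] [Module F W] {Q : QuadraticForm F W}
    {s r k : ℕ} {R : QuadraticForm F (Fin r → F)} (h : Decomposes Q s r k R) (e : V ≃ₗ[F] W)
    {Q' : QuadraticForm F V} (hQ : ∀ x, Q' x = Q (e x)) : Decomposes Q' s r k R := by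
  obtain ⟨f, hf⟩ := h
  exact ⟨e ≪≫ₗ f, fun x => by simp [hQ, hf]⟩

/-- A form all of whose singular vectors lie in the radical is anisotropic up to its radical. -/
lemma exists_decomposes_of_singular_le_radical [Module.Finite F V] (Q : QuadraticForm F V)
    (h : ∀ x, Q x = 0 → x ∈ QuadraticMap.radical Q) :
    ∃ (r k : ℕ) (R : QuadraticForm F (Fin r → F)), r ≤ 2 ∧ R.Anisotropic ∧
      Decomposes Q 0 r k R := by
  obtain ⟨C, hC⟩ := Submodule.exists_isCompl (QuadraticMap.radical Q)
  let b := (Module.finBasis F C).equivFun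
  let c := (Module.finBasis F (QuadraticMap.radical Q)).equivFun
  have hR : (Q.comp C.subtype).Anisotropic := by
    intro x hx
    have h1 : (x : V) ∈ QuadraticMap.radical Q ⊓ C := ⟨h _ hx, x.2⟩
    rw [hC.inf_eq_bot] at h1
    exact Subtype.ext h1
  let E := C.prodEquivOfIsCompl (QuadraticMap.radical Q) hC.symm
  have hE (p : C × QuadraticMap.radical Q) : Q (E p) = Q p.1 := by
    have h1 : E p = p.2 + p.1 := by
      rw [add_comm]
      exact Submodule.coe_prodEquivOfIsCompl' _ _ _ p
    rw [h1]
    exact (QuadraticMap.mem_radical_iff'.1 p.2.2).2 _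
  refine ⟨_, _, (Q.comp C.subtype).comp b.symm.toLinearMap, finrank_le_two_of_anisotropic _ hR,
    ?_, E.symm ≪≫ₗ b.prodCongr c ≪≫ₗ LinearEquiv.ofLinearMap (LinearMap.inr F _ _)
      (LinearMap.snd F ((Fin 0 → F) × (Fin 0 → F)) _) ?_ rfl, ?_⟩
  · intro x hx
    exact b.symm.map_eq_zero_iff.1 (hR _ hx)
  · exact LinearMap.ext fun p => Prod.ext (Subsingleton.elim _ _) rfl
  · intro v
    obtain ⟨p, rfl⟩ := E.surjective v
    rw [hE]
    simp [LinearEquiv.ofLinearMap]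

lemma exists_decomposes_fin (n : ℕ) : ∀ Q : QuadraticForm F (Fin n → F),
    ∃ (s r k : ℕ) (R : QuadraticForm F (Fin r → F)), r ≤ 2 ∧ R.Anisotropic ∧
      Decomposes Q s r k R := by
  induction n using Nat.strong_induction_on with
  | _ n ih =>
    intro Q
    by_cases h : ∀ x, Q x = 0 → x ∈ QuadraticMap.radical Q
    · exact ⟨0, exists_decomposes_of_singular_le_radical Q h⟩
    · push Not at h
      obtain ⟨x, hx, hr⟩ := h
      obtain ⟨n', e, Q', hQ'⟩ := exists_split_plane hx hr
      have hn : n' < n := by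
        have := e.finrank_eq
        simp at this
        omega
      obtain ⟨s, r, k, R, hr, hR, f, hf⟩ := ih n' hn Q'
      let T : ((F × F) × (((Fin s → F) × (Fin s → F)) × ((Fin r → F) × (Fin k → F)))) ≃ₗ[F]
          ((Fin (s + 1) → F) × (Fin (s + 1) → F)) × ((Fin r → F) × (Fin k → F)) :=
        (LinearEquiv.prodAssoc F (F × F) ((Fin s → F) × (Fin s → F))
            ((Fin r → F) × (Fin k → F))).symm ≪≫ₗ
          ((LinearEquiv.prodProdProdComm F _ _ _ _ ≪≫ₗ
            (Fin.consLinearEquiv F fun _ => F).prodCongr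
              (Fin.consLinearEquiv F fun _ => F)).prodCongr (LinearEquiv.refl F _))
      refine ⟨s + 1, r, k, R, hr, hR, e ≪≫ₗ (LinearEquiv.refl F _).prodCongr f ≪≫ₗ T, fun v => ?_⟩
      rw [hQ', hf]
      simp [T, dotProduct, Fin.sum_univ_succ, add_assoc]
      rfl

/-- Every quadratic form over a finite field is the orthogonal sum of hyperbolic planes, an
anisotropic form in at most two variables, and a zero form. -/
lemma exists_decomposes [Module.Finite F V] (Q : QuadraticForm F V) :
    ∃ (s r k : ℕ) (R : QuadraticForm F (Fin r → F)), r ≤ 2 ∧ R.Anisotropic ∧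
      Decomposes Q s r k R := by
  let b := (Module.finBasis F V).equivFun
  obtain ⟨s, r, k, R, hr, hR, h⟩ := exists_decomposes_fin _ (Q.comp b.symm.toLinearMap)
  exact ⟨s, r, k, R, hr, hR, h.comp b fun x => by simp⟩

omit [Finite F] in
lemma Decomposes.finrank_eq {Q : QuadraticForm F V} {s r k : ℕ} {R : QuadraticForm F (Fin r → F)}
    (h : Decomposes Q s r k R) : Module.finrank F V = 2 * s + r + k := by
  obtain ⟨e, -⟩ := h
  rw [e.finrank_eq]
  simp
  omega

omit [Finite F] in
/-- The radical consists of the last `k` coordinates. -/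
lemma Decomposes.rank_eq {Q : QuadraticForm F V} {s r k : ℕ} {R : QuadraticForm F (Fin r → F)}
    (hR : R.Anisotropic) (h : Decomposes Q s r k R) : rank Q = 2 * s + r := by
  obtain ⟨e, he⟩ := h
  let π : V →ₗ[F] ((Fin s → F) × (Fin s → F)) × (Fin r → F) :=
    (LinearMap.prodMap LinearMap.id (LinearMap.fst F _ (Fin k → F))) ∘ₗ e.toLinearMap
  have hπ (x : V) : π x = ((e x).1, (e x).2.1) := rfl
  have hsurj : Function.Surjective π := fun p =>
    ⟨e.symm (p.1, (p.2, 0)), by simp [hπ]⟩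
  have hker : LinearMap.ker π = QuadraticMap.radical Q := by
    ext x
    rw [LinearMap.mem_ker, QuadraticMap.mem_radical_iff', hπ]
    constructor
    · intro h
      simp only [Prod.mk_eq_zero] at h
      constructor
      · rw [he, h.1, h.2]
        simp
      · intro y
        simp only [he, map_add, Prod.fst_add, Prod.snd_add, h.1, h.2]
        simp
    · rintro ⟨h0, h1⟩
      rw [he] at h0
      have h2 (u v : Fin s → F) : (e x).1.1 ⬝ᵥ v + u ⬝ᵥ (e x).1.2 = 0 := by
        have := h1 (e.symm ((u, v), (0, 0)))
        simp only [he, map_add, Prod.fst_add, Prod.snd_add, LinearEquiv.apply_symm_apply,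
          add_zero, add_dotProduct, dotProduct_add, map_zero] at this
        linear_combination this - h0
      have ha : (e x).1.1 = 0 := by
        refine dotProduct_eq_zero_iff.1 fun v => ?_
        simpa using h2 0 v
      have hb : (e x).1.2 = 0 := by
        refine dotProduct_eq_zero_iff.1 fun v => ?_
        simpa [dotProduct_comm] using h2 v 0
      rw [ha, hb] at h0
      have hz := hR (e x).2.1 (by simpa using h0)
      rw [hz]
      ext <;> simp [ha, hb]
  rw [rank, ← hker, (π.quotKerEquivOfSurjective hsurj).finrank_eq]
  simp
  omega

end Classification

/-! ### Traces, binary forms and the orbits of the standard forms -/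

section Trace

variable {F : Type*} [Field F] [Fintype F]

/-- In characteristic two, the trace may be computed with the exponents `2 ^ 0, …, 2 ^ (n - 1)`,
as `y ^ 2 ^ n = y`. -/
lemma absTrace_eq (h2 : ringChar F = 2) :
    ∃ n, 1 ≤ n ∧ Fintype.card F = 2 ^ n ∧
      ∀ y : F, absTrace y = ∑ i ∈ Finset.range n, y ^ 2 ^ i := by
  obtain ⟨n, -, hn⟩ := FiniteField.card F (ringChar F)
  rw [h2] at hn
  refine ⟨n, n.2, hn, fun y => ?_⟩
  have h1 : Nat.log (ringChar F) (Nat.card F) = n := by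
    rw [h2, Nat.card_eq_fintype_card, hn, Nat.log_pow (by norm_num)]
  have h3 : y ^ 2 ^ (n : ℕ) = y := by rw [← hn, FiniteField.pow_card]
  have h4 := Finset.sum_range_succ (fun i => y ^ 2 ^ i) (n : ℕ)
  rw [Finset.sum_range_succ', h3, pow_zero, pow_one] at h4
  rw [absTrace, h1, h2, ← add_right_cancel h4, ← Finset.Ico_add_one_right_eq_Icc,
    Finset.sum_Ico_eq_sum_range]
  simp only [Nat.add_sub_cancel, add_comm 1]

lemma absTrace_sq_add_self (h2 : ringChar F = 2) (t : F) : absTrace (t ^ 2 + t) = 0 := by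
  have : CharP F 2 := by rw [← h2]; exact ringChar.charP F
  obtain ⟨n, hn1, hn, h⟩ := absTrace_eq (F := F) h2
  rw [h]
  have h3 (i : ℕ) : (t ^ 2 + t) ^ 2 ^ i = t ^ 2 ^ (i + 1) - t ^ 2 ^ i := by
    rw [add_pow_char_pow, ← pow_mul, ← pow_succ', CharTwo.sub_eq_add]
  simp only [h3]
  rw [Finset.sum_range_sub (fun i => t ^ 2 ^ i), ← hn, FiniteField.pow_card]
  simp

/-- In characteristic two, the elements of trace zero are those of the form `t ^ 2 + t`, by
comparing the degree of the trace polynomial with the size of the image of `t ↦ t ^ 2 + t`. -/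
lemma absTrace_eq_one (h2 : ringChar F = 2) {α : F} (hα : ∀ t : F, t ^ 2 + t ≠ α) :
    absTrace α = 1 := by
  classical
  have : CharP F 2 := by rw [← h2]; exact ringChar.charP F
  obtain ⟨n, hn1, hn, h⟩ := absTrace_eq (F := F) h2
  have hsq : absTrace α ^ 2 = absTrace α := by
    have h3 : absTrace α ^ 2 - absTrace α = 0 := by
      rw [h, sum_pow_char, ← Finset.sum_sub_distrib]
      simp only [← pow_mul, ← pow_succ]
      rw [Finset.sum_range_sub (fun i => α ^ 2 ^ i), ← hn, FiniteField.pow_card]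
      simp
    exact sub_eq_zero.1 h3
  have h01 : absTrace α = 0 ∨ absTrace α = 1 := by
    have : absTrace α * (absTrace α - 1) = 0 := by linear_combination hsq
    exact (mul_eq_zero.1 this).imp id sub_eq_zero.1
  refine h01.resolve_left fun h0 => ?_
  let P : F[X] := ∑ i ∈ Finset.range n, X ^ 2 ^ i
  obtain ⟨k, rfl⟩ := Nat.exists_eq_add_of_le' hn1
  have hP : P.natDegree ≤ 2 ^ k := by
    refine natDegree_sum_le_of_forall_le _ _ fun i hi => ?_
    rw [natDegree_X_pow]
    exact Nat.pow_le_pow_right (by norm_num) (Nat.lt_succ_iff.1 (Finset.mem_range.1 hi))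
  have hP0 : P ≠ 0 := by
    intro h0
    have h3 : P.coeff 1 = 1 := by
      simp only [P, finsetSum_coeff, coeff_X_pow]
      rw [Finset.sum_eq_single_of_mem 0 (by simp)]
      · simp
      · intro i _ hi
        rw [if_neg]
        exact (Nat.one_lt_two_pow hi).ne
    rw [h0] at h3
    simp at h3
  have hker : (Finset.univ.filter fun y : F => absTrace y = 0).card ≤ 2 ^ k := by
    refine le_trans (Finset.card_le_card ?_) ((Multiset.toFinset_card_le _).trans
      ((card_roots' P).trans hP))
    intro y hy
    rw [Multiset.mem_toFinset, mem_roots hP0, IsRoot, eval_finsetSum]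
    simpa [h] using hy
  have himg : 2 ^ k ≤ (Finset.univ.image fun t : F => t ^ 2 + t).card := by
    have h3 := Finset.card_le_mul_card_image (f := fun t : F => t ^ 2 + t) Finset.univ 2 (by
      intro b hb
      have := zeros_quadratic_le_two (one_ne_zero (α := F)) 1 (-b)
      rw [zeros, Set.ncard_eq_toFinset_card'] at this
      convert this using 2
      ext t
      simp [add_neg_eq_zero])
    rw [Finset.card_univ, hn, pow_succ'] at h3
    omega
  have hsub : (Finset.univ.image fun t : F => t ^ 2 + t)
      ⊆ Finset.univ.filter fun y : F => absTrace y = 0 := by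
    intro y hy
    obtain ⟨t, -, rfl⟩ := Finset.mem_image.1 hy
    simp [absTrace_sq_add_self h2]
  have heq := Finset.eq_of_subset_of_card_le hsub (hker.trans himg)
  have hmem : α ∈ Finset.univ.image fun t : F => t ^ 2 + t := by
    rw [heq]
    simp [h0]
  obtain ⟨t, -, ht⟩ := Finset.mem_image.1 hmem
  exact hα t ht

end Trace

section BinaryForms

variable {F : Type*} [Field F]

lemma binaryForm_two_apply (b c : F) (z : Fin 2 → F) :
    binaryForm 2 0 1 b c z = z 0 ^ 2 + b * (z 0 * z 1) + c * z 1 ^ 2 := by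
  simp [binaryForm, coord]
  ring

/-- The parameters of the anisotropic normal forms `x ^ 2 + b x y + c y ^ 2`: in characteristic
two, `b = 1` and `c` has trace one; otherwise, `b = 0` and `-c` is not a square. -/
def IsEllipticParam (b c : F) : Prop :=
  (ringChar F = 2 ∧ b = 1 ∧ absTrace c = 1) ∨ (ringChar F ≠ 2 ∧ b = 0 ∧ ¬ IsSquare (-c))

variable [Fintype F]

lemma anisotropic_binaryForm {b c : F} (h : IsEllipticParam b c) :
    (binaryForm 2 0 1 b c).Anisotropic := by
  intro z hz
  rw [binaryForm_two_apply] at hz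
  have h1 : z 1 = 0 := by
    by_contra h0
    rcases h with ⟨h2, rfl, hc⟩ | ⟨h2, rfl, hc⟩
    · have : CharP F 2 := by rw [← h2]; exact ringChar.charP F
      have h3 := absTrace_sq_add_self h2 (z 0 / z 1)
      have h4 : (z 0 / z 1) ^ 2 + z 0 / z 1 = c := by
        have h5 : (z 0 / z 1) ^ 2 + z 0 / z 1 + c = 0 := by
          field_simp
          linear_combination hz
        rw [← CharTwo.sub_eq_add, sub_eq_zero] at h5
        exact h5
      rw [h4, hc] at h3
      exact one_ne_zero h3
    · apply hc
      refine ⟨z 0 / z 1, ?_⟩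
      field_simp
      linear_combination -hz
  have h0 : z 0 = 0 := by
    rw [h1] at hz
    simpa using hz
  ext i
  fin_cases i
  · exact h0
  · exact h1

/-- An anisotropic binary form is a multiple of one of the normal forms. -/
lemma exists_binary_normal_form {Z : Type*} [AddCommGroup Z] [Module F Z]
    (hZ : Module.finrank F Z = 2) (R : QuadraticForm F Z) (hR : R.Anisotropic) :
    ∃ (b c : F) (a : Fˣ) (T : Z ≃ₗ[F] (Fin 2 → F)), IsEllipticParam b c ∧
      ∀ z, R z = a * binaryForm 2 0 1 b c (T z) := by
  have : Module.Finite F Z := Module.finite_of_finrank_eq_succ hZ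
  have : Nontrivial Z := Module.nontrivial_of_finrank_pos (R := F) (by omega)
  obtain ⟨x, hx⟩ := exists_ne (0 : Z)
  have ha : R x ≠ 0 := fun h => hx (hR _ h)
  obtain ⟨y, hli, hy⟩ : ∃ y, (∀ u v : F, u • x + v • y = 0 → u = 0 ∧ v = 0) ∧
      ((ringChar F = 2 ∧ QuadraticMap.polar R x y = R x) ∨
        (ringChar F ≠ 2 ∧ QuadraticMap.polar R x y = 0)) := by
    by_cases h2 : ringChar F = 2
    · classical
      have : CharP F 2 := by rw [← h2]; exact ringChar.charP F
      obtain ⟨y, h3⟩ : ∃ y, QuadraticMap.polar R x y = R x := by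
        obtain ⟨y, hy⟩ := exists_polar_ne_zero hZ R hR hx
        refine ⟨(R x / QuadraticMap.polar R x y) • y, ?_⟩
        rw [QuadraticMap.polar_smul_right, smul_eq_mul, div_mul_cancel₀ _ hy]
      refine ⟨y, fun u v huv => ?_, Or.inl ⟨h2, h3⟩⟩
      have h4 := congrArg (R.polarBilin x) huv
      simp only [map_add, map_smul, QuadraticMap.polarBilin_apply_apply, h3, map_zero,
        QuadraticMap.polar_self, two_nsmul, CharTwo.add_self_eq_zero, smul_zero, zero_add] at h4
      have hv : v = 0 := (smul_eq_zero.1 h4).resolve_right ha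
      rw [hv, zero_smul, add_zero] at huv
      exact ⟨(smul_eq_zero.1 huv).resolve_right hx, hv⟩
    · have h2' : (2 : F) ≠ 0 := Ring.two_ne_zero h2
      obtain ⟨y, hy, hy0⟩ : ∃ y, QuadraticMap.polar R x y = 0 ∧ y ≠ 0 := by
        have h3 : LinearMap.ker (R.polarBilin x) ≠ ⊥ := by
          intro h
          have h4 := LinearMap.finrank_range_add_finrank_ker (R.polarBilin x)
          rw [h, finrank_bot, hZ] at h4
          have h5 := Submodule.finrank_le (LinearMap.range (R.polarBilin x))
          rw [Module.finrank_self] at h5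
          omega
        obtain ⟨y, hy, hy0⟩ := Submodule.exists_mem_ne_zero_of_ne_bot h3
        exact ⟨y, by simpa using hy, hy0⟩
      refine ⟨y, fun u v huv => ?_, Or.inr ⟨h2, hy⟩⟩
      have h4 := congrArg (R.polarBilin x) huv
      simp only [map_add, map_smul, QuadraticMap.polarBilin_apply_apply, hy, map_zero,
        QuadraticMap.polar_self, smul_eq_mul, nsmul_eq_mul, mul_zero, add_zero] at h4
      have hu : u = 0 := (mul_eq_zero.1 h4).resolve_right (mul_ne_zero (by simpa using h2') ha)
      rw [hu, zero_smul, zero_add] at huv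
      exact ⟨hu, (smul_eq_zero.1 huv).resolve_right hy0⟩
  let f : (Fin 2 → F) →ₗ[F] Z := (LinearMap.proj 0).smulRight x + (LinearMap.proj 1).smulRight y
  have hf (u : Fin 2 → F) : f u = u 0 • x + u 1 • y := rfl
  have hinj : Function.Injective f := by
    rw [injective_iff_map_eq_zero]
    intro u hu
    obtain ⟨h0, h1⟩ := hli _ _ ((hf u).symm.trans hu)
    ext i
    fin_cases i
    · exact h0
    · exact h1
  let T := LinearMap.linearEquivOfInjective f hinj (by simp [hZ])
  have hT (u : Fin 2 → F) : T u = u 0 • x + u 1 • y := rfl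
  have hform : ∀ z, R z = R x * binaryForm 2 0 1 (QuadraticMap.polar R x y / R x) (R y / R x)
      (T.symm z) := by
    intro z
    obtain ⟨u, rfl⟩ := T.surjective z
    rw [LinearEquiv.symm_apply_apply, hT, binaryForm_two_apply, QuadraticMap.map_add R,
      QuadraticMap.map_smul, QuadraticMap.map_smul, QuadraticMap.polar_smul_left,
      QuadraticMap.polar_smul_right]
    simp only [smul_eq_mul]
    field_simp
    ring
  refine ⟨_, _, Units.mk0 _ ha, T.symm, ?_, hform⟩
  -- the dehomogenized form has no roots, as `R` is anisotropic
  have han : ∀ t : F, t ^ 2 + QuadraticMap.polar R x y / R x * t + R y / R x ≠ 0 := by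
    intro t ht
    have h3 := hform (T ![t, 1])
    rw [LinearEquiv.symm_apply_apply, binaryForm_two_apply] at h3
    simp only [Matrix.cons_val_zero, Matrix.cons_val_one, mul_one, one_pow] at h3
    rw [ht, mul_zero] at h3
    have h4 := T.map_eq_zero_iff.1 (hR _ h3)
    simpa using congrFun h4 1
  rcases hy with ⟨h2, hy⟩ | ⟨h2, hy⟩
  · have : CharP F 2 := by rw [← h2]; exact ringChar.charP F
    refine Or.inl ⟨h2, by rw [hy, div_self ha], absTrace_eq_one h2 fun t ht => han t ?_⟩
    rw [hy, div_self ha, one_mul, ht, CharTwo.add_self_eq_zero]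
  · refine Or.inr ⟨h2, by rw [hy, zero_div], fun ⟨t, ht⟩ => han t ?_⟩
    rw [hy]
    linear_combination -ht

end BinaryForms

section Orbits

variable {F : Type*} [Field F] {V : Type*} [AddCommGroup V] [Module F V]

/-- The linear map that sorts the coordinates of `F ^ m` into those of the hyperbolic planes, of
the anisotropic part and of the radical. -/
noncomputable def sortCoords (F : Type*) [Field F] (m s r k : ℕ) :
    (Fin m → F) →ₗ[F] ((Fin s → F) × (Fin s → F)) × ((Fin r → F) × (Fin k → F)) :=
  ((LinearMap.pi fun i : Fin s => coord F m (2 * i)).prod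
    (LinearMap.pi fun i : Fin s => coord F m (2 * i + 1))).prod
    ((LinearMap.pi fun j : Fin r => coord F m (2 * s + j)).prod
      (LinearMap.pi fun j : Fin k => coord F m (2 * s + r + j)))

lemma sortCoords_injective {m s r k : ℕ} (hm : m = 2 * s + r + k) :
    Function.Injective (sortCoords F m s r k) := by
  rw [injective_iff_map_eq_zero]
  intro v hv
  simp only [sortCoords, LinearMap.prod_apply, Function.prod, Prod.mk_eq_zero] at hv
  obtain ⟨⟨h1, h2⟩, h3, h4⟩ := hv
  have hc (j : Fin m) : coord F m j v = v j := by simp [coord]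
  ext j
  rw [← hc]
  by_cases hj1 : (j : ℕ) < 2 * s
  · rcases Nat.even_or_odd' (j : ℕ) with ⟨i, hi | hi⟩
    · rw [hi]
      exact congrFun h1 ⟨i, by omega⟩
    · rw [hi]
      exact congrFun h2 ⟨i, by omega⟩
  · by_cases hj2 : (j : ℕ) < 2 * s + r
    · obtain ⟨i, hi⟩ := Nat.exists_eq_add_of_le (not_lt.1 hj1)
      rw [hi]
      exact congrFun h3 ⟨i, by omega⟩
    · obtain ⟨i, hi⟩ := Nat.exists_eq_add_of_le (not_lt.1 hj2)
      rw [hi]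
      exact congrFun h4 ⟨i, by omega⟩

/-- The linear equivalence given by `sortCoords`. -/
noncomputable def sortEquiv (F : Type*) [Field F] {m s r k : ℕ} (hm : m = 2 * s + r + k) :
    (Fin m → F) ≃ₗ[F] ((Fin s → F) × (Fin s → F)) × ((Fin r → F) × (Fin k → F)) :=
  LinearMap.linearEquivOfInjective (sortCoords F m s r k) (sortCoords_injective hm)
    (by simp; omega)

lemma hyperbolicSum_apply {m s r k : ℕ} (hm : m = 2 * s + r + k) (v : Fin m → F) :
    hyperbolicSum F m s v = (sortEquiv F hm v).1.1 ⬝ᵥ (sortEquiv F hm v).1.2 := by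
  rw [hyperbolicSum, _root_.sum_apply, Finset.sum_range]
  rfl

lemma binaryForm_apply {m s k : ℕ} (hm : m = 2 * s + 2 + k) (a b c : F) (v : Fin m → F) :
    binaryForm m (2 * s) a b c v = binaryForm 2 0 a b c (sortEquiv F hm v).2.1 := by
  have h0 : (sortEquiv F hm v).2.1 0 = coord F m (2 * s) v := rfl
  have h1 : (sortEquiv F hm v).2.1 1 = coord F m (2 * s + 1) v := rfl
  simp only [binaryForm, _root_.add_apply, _root_.smul_apply,
    QuadraticMap.linMulLin_apply, ← h0, ← h1]
  simp [coord]

/-- The scalar factor of an orbit can be absorbed into the hyperbolic planes. -/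
lemma Decomposes.of_orbit {m s r k : ℕ} (hm : m = 2 * s + r + k) {Q : QuadraticForm F V}
    (N : QuadraticForm F (Fin r → F)) (a : Fˣ) (L : V ≃ₗ[F] (Fin m → F))
    (h : ∀ x, Q x = a * (hyperbolicSum F m s (L x) + N (sortEquiv F hm (L x)).2.1)) :
    Decomposes Q s r k ((a : F) • N) := by
  refine ⟨L ≪≫ₗ sortEquiv F hm ≪≫ₗ
    ((LinearEquiv.smulOfNeZero F (Fin s → F) (a : F) a.ne_zero).prodCongr
      (LinearEquiv.refl F _)).prodCongr (LinearEquiv.refl F _), fun x => ?_⟩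
  rw [h, hyperbolicSum_apply hm]
  simp [smul_dotProduct, mul_add]

/-- Conversely, a decomposition whose anisotropic part is a multiple of `N` gives an orbit
representation; the scalar is extracted from the hyperbolic planes. -/
lemma Decomposes.exists_orbit {s r k : ℕ} {Q : QuadraticForm F V} {R : QuadraticForm F (Fin r → F)}
    (h : Decomposes Q s r k R) (hm : Module.finrank F V = 2 * s + r + k)
    (N : QuadraticForm F (Fin r → F)) (a : Fˣ) (T : (Fin r → F) ≃ₗ[F] (Fin r → F))
    (hR : ∀ z, R z = a * N (T z)) :
    ∃ L : V ≃ₗ[F] (Fin (Module.finrank F V) → F), ∀ x,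
      Q x = a * (hyperbolicSum F (Module.finrank F V) s (L x) + N (sortEquiv F hm (L x)).2.1) := by
  obtain ⟨e, he⟩ := h
  refine ⟨e ≪≫ₗ ((LinearEquiv.smulOfNeZero F (Fin s → F) (a : F)⁻¹
    (inv_ne_zero a.ne_zero)).prodCongr (LinearEquiv.refl F _)).prodCongr
      (T.prodCongr (LinearEquiv.refl F _)) ≪≫ₗ (sortEquiv F hm).symm, fun x => ?_⟩
  rw [he, hR, hyperbolicSum_apply hm]
  simp [smul_dotProduct, mul_add]

lemma isHyperbolic_iff {s : ℕ} {Q : QuadraticForm F V} {k : ℕ}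
    (hm : Module.finrank F V = 2 * s + 0 + k) :
    IsHyperbolic s Q ↔ Decomposes Q s 0 k 0 := by
  constructor
  · rintro ⟨a, L, h⟩
    have := Decomposes.of_orbit hm (Q := Q) 0 a L (fun x => by simp [h])
    simpa using this
  · intro h
    obtain ⟨L, hL⟩ := h.exists_orbit hm 0 1 (LinearEquiv.refl F _) (by simp)
    exact ⟨1, L, fun x => by simp [hL]⟩

/-- The definition of elliptic forms, with the two characteristics treated uniformly. -/
lemma isElliptic_iff {s : ℕ} {Q : QuadraticForm F V} :
    IsElliptic s Q ↔ 1 ≤ s ∧ ∃ b c : F, IsEllipticParam b c ∧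
      InOrbit (hyperbolicSum F (Module.finrank F V) (s - 1)
        + binaryForm (Module.finrank F V) (2 * (s - 1)) 1 b c) Q := by
  unfold IsElliptic IsEllipticParam
  refine and_congr_right fun _ => ⟨?_, ?_⟩
  · rintro (⟨h2, α, hα, h⟩ | ⟨h2, β, hβ, h⟩)
    · exact ⟨1, α, Or.inl ⟨h2, rfl, hα⟩, h⟩
    · exact ⟨0, -β, Or.inr ⟨h2, rfl, by rwa [neg_neg]⟩, h⟩
  · rintro ⟨b, c, ⟨h2, rfl, hc⟩ | ⟨h2, rfl, hc⟩, h⟩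
    · exact Or.inl ⟨h2, c, hc, h⟩
    · exact Or.inr ⟨h2, -c, hc, by rwa [neg_neg]⟩

lemma isElliptic_succ_iff [Fintype F] {s k : ℕ} {Q : QuadraticForm F V}
    (hm : Module.finrank F V = 2 * s + 2 + k) :
    IsElliptic (s + 1) Q ↔ ∃ R : QuadraticForm F (Fin 2 → F), R.Anisotropic ∧
      Decomposes Q s 2 k R := by
  rw [isElliptic_iff]
  constructor
  · rintro ⟨-, b, c, hbc, a, L, h⟩
    refine ⟨(a : F) • binaryForm 2 0 1 b c, ?_, Decomposes.of_orbit hm _ a L fun x => ?_⟩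
    · intro z hz
      refine anisotropic_binaryForm hbc z ?_
      simpa using hz
    · rw [h, _root_.add_apply, Nat.add_sub_cancel, binaryForm_apply hm]
  · rintro ⟨R, hR, h⟩
    obtain ⟨b, c, a, T, hbc, hT⟩ := exists_binary_normal_form (by simp) R hR
    obtain ⟨L, hL⟩ := h.exists_orbit hm _ a T hT
    refine ⟨by omega, b, c, hbc, a, L, fun x => ?_⟩
    rw [hL, _root_.add_apply, Nat.add_sub_cancel, binaryForm_apply hm]

end Orbits

/-! ### Weight enumerators of cosets -/

section Enumerator

variable {F : Type*} [Field F] [Fintype F] [DecidableEq F] {V : Type*} [AddCommGroup V] [Module F V]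

/-- The affine sum of a form is obtained from that of its anisotropic part `R`. Here `m + 1` is the
dimension, `M n` is the number of zeros of `Q + l + c` if the anisotropic part contributes `n`
zeros and `l` vanishes on the radical, and `H 0` and `H 1` are the numbers of representations of
zero and of a nonzero scalar by the sum of the `s` hyperbolic planes. -/
lemma Decomposes.affineSum_eq {A : Type*} [AddCommGroup A] [Module ℚ A]
    [Fintype (Module.Dual F V)] {q m s r k : ℕ} (hq : Fintype.card F = q)
    {Q : QuadraticForm F V} {R : QuadraticForm F (Fin r → F)} [Fintype (Module.Dual F (Fin r → F))]
    (h : Decomposes Q s r k R) (hm : m + 1 = 2 * s + r + k) (Φ₀ Φ₁ : ℕ → A) (H : ℕ → ℚ)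
    (M : ℕ → ℕ) (hH : ∀ i, H i = ((q : ℚ) ^ s * ((q : ℚ) ^ s - 1)) / q
      + if i = 0 then (q : ℚ) ^ s else 0)
    (hM : ∀ n, M n = (q ^ r * hyperbolicCount q s + q ^ s * n) * q ^ k) :
    affineSum Q Φ₀ Φ₁ = affineSum R
        (fun n => H 0 • Φ₀ (M n) + ((q : ℚ) ^ (2 * s) - H 0) • Φ₁ (M n))
        (fun n => H 1 • Φ₀ (M n) + ((q : ℚ) ^ (2 * s) - H 1) • Φ₁ (M n))
      + ((q : ℚ) ^ (2 * s + r) * ((q : ℚ) ^ k - 1)) •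
        (Φ₀ (q ^ m) + ((q : ℚ) - 1) • Φ₁ (q ^ m)) := by
  subst hq
  obtain ⟨e, he⟩ := h
  have hfin (W : Type _) [AddCommGroup W] [Module F W] [Module.Finite F W] :
      Finite (Module.Dual F W) := Module.finite_of_finite F
  let _ : Fintype (Module.Dual F (((Fin s → F) × (Fin s → F)) × (Fin r → F))) :=
    @Fintype.ofFinite _ (hfin _)
  let _ : Fintype (Module.Dual F ((((Fin s → F) × (Fin s → F)) × (Fin r → F)) × (Fin k → F))) :=
    @Fintype.ofFinite _ (hfin _)
  let E := e ≪≫ₗ (LinearEquiv.prodAssoc F ((Fin s → F) × (Fin s → F)) (Fin r → F)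
    (Fin k → F)).symm
  have hQ : (Q : V → F) = fun x => (fun p : (((Fin s → F) × (Fin s → F)) × (Fin r → F)) ×
      (Fin k → F) => p.1.1.1 ⬝ᵥ p.1.1.2 + R p.1.2) (E x) := funext he
  rw [hQ, affineSum_comp_equiv E (fun p : (((Fin s → F) × (Fin s → F)) × (Fin r → F)) ×
    (Fin k → F) => p.1.1.1 ⬝ᵥ p.1.1.2 + R p.1.2),
    affineSum_prod_radical (fun p : ((Fin s → F) × (Fin s → F)) × (Fin r → F) =>
      p.1.1 ⬝ᵥ p.1.2 + R p.2) Φ₀ Φ₁ (Fintype.card F ^ m)]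
  · obtain ⟨h, hh⟩ : ∃ h : ℕ → ℕ, ∀ i, h i = hyperbolicCount (Fintype.card F) s
        + if i = 0 then Fintype.card F ^ s else 0 := ⟨_, fun _ => rfl⟩
    rw [affineSum_dotProduct_add s R _ _ h
      (fun n => Nat.card (Fin r → F) * hyperbolicCount (Fintype.card F) s
        + Fintype.card F ^ s * n) hh (fun _ => rfl)]
    have h1 (i : ℕ) : (h i : ℚ) = H i := by
      rw [hH, hh, Nat.cast_add, cast_hyperbolicCount Fintype.card_pos]
      push_cast
      rfl
    have h2 : ((Nat.card (((Fin s → F) × (Fin s → F)) × (Fin r → F)) : ℚ)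
        * (Nat.card (Fin k → F) - 1))
        = (Fintype.card F : ℚ) ^ (2 * s + r) * ((Fintype.card F : ℚ) ^ k - 1) := by
      simp only [Nat.card_eq_fintype_card, Fintype.card_prod, Fintype.card_pi, Finset.prod_const,
        Finset.card_univ, Fintype.card_fin]
      push_cast
      ring
    simp only [h1, h2, hM]
    simp only [Nat.card_eq_fintype_card, Fintype.card_pi, Finset.prod_const,
      Finset.card_univ, Fintype.card_fin]
  · simp only [Nat.card_eq_fintype_card, Fintype.card_prod, Fintype.card_pi, Finset.prod_const,
      Finset.card_univ, Fintype.card_fin]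
    rw [← pow_succ', hm]
    ring

lemma mul_hyperbolicCount_add {q : ℕ} (hq : 1 ≤ q) (s : ℕ) :
    q * hyperbolicCount q s + q ^ s = q ^ s * q ^ s := by
  unfold hyperbolicCount
  rcases s with _ | s
  · simp
  · obtain ⟨c, hc⟩ := Nat.exists_eq_add_of_le' (Nat.one_le_pow (s + 1) q hq)
    rw [hc, Nat.add_sub_cancel, Nat.add_sub_cancel, ← hc]
    have h1 : q * (c * q ^ s) = c * q ^ (s + 1) := by ring
    rw [h1]
    nth_rewrite 3 [hc]
    ring

lemma natSub_eq_toNat {x y : ℕ} {z : ℤ} (h : (x : ℤ) - y = z) : x - y = z.toNat := by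
  omega

/-- The weight enumerator of the coset of a hyperbolic form. -/
lemma Decomposes.affineSum_hyperbolic [Fintype (Module.Dual F V)] {q m s k : ℕ}
    (hq : Fintype.card F = q) {Q : QuadraticForm F V} {R : QuadraticForm F (Fin 0 → F)}
    (h : Decomposes Q s 0 k R) (hm : m + 1 = 2 * s + 0 + k) :
    affineSum Q (fun n => (X : ℚ[X]) ^ (q ^ (m + 1) - n)) (fun n => X ^ (q ^ (m + 1) - (n + 1)))
      = omega q (m + 1) (Sum.inr (s, 1)) := by
  have : Finite (Module.Dual F (Fin 0 → F)) := Module.finite_of_finite F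
  let _ : Fintype (Module.Dual F (Fin 0 → F)) := Fintype.ofFinite _
  have hq1 : 1 ≤ q := hq ▸ Fintype.card_pos
  have hq0 : (q : ℚ) ≠ 0 := by positivity
  rw [h.affineSum_eq hq hm _ _ _ _ (fun _ => rfl) (fun _ => rfl),
    affineSum_of_subsingleton _ (map_zero R), hq]
  -- `q * a` is the number of points; the numbers of zeros are expressed through `a` and `b`
  obtain ⟨b, hb⟩ : ∃ b, b = q ^ (m + 1 - s - 1) := ⟨_, rfl⟩
  obtain ⟨a, ha⟩ : ∃ a, a = q ^ m := ⟨_, rfl⟩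
  have hbq : q ^ s * q ^ k = q * b := by
    rw [hb, ← pow_succ', ← pow_add]
    congr 1
    omega
  have hG : hyperbolicCount q s * q ^ k + b = a := by
    have h1 := mul_hyperbolicCount_add hq1 s
    have h2 : q * (hyperbolicCount q s * q ^ k + b) = q * a := by
      rw [mul_add, ← hbq, ← mul_assoc, ← add_mul, h1, ha, ← pow_succ', hm]
      ring
    exact Nat.eq_of_mul_eq_mul_left hq1 h2
  have hGz : ((hyperbolicCount q s * q ^ k : ℕ) : ℤ) = a - b := by
    rw [← hG]; push_cast; ring
  have hbz : (q : ℤ) ^ s * (q : ℤ) ^ k = q * b := by exact_mod_cast hbq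
  have haq : ((q : ℤ) ^ (m + 1)) = q * a := by rw [ha]; push_cast; ring
  have e1 : q ^ (m + 1) - (q ^ 0 * hyperbolicCount q s + q ^ s * 1) * q ^ k
      = (((a : ℤ) - ((1 : ℤˣ) : ℤ) * b) * (q - 1)).toNat := by
    apply natSub_eq_toNat
    push_cast at hGz ⊢
    linear_combination haq - hGz - hbz
  have e2 : q ^ (m + 1) - ((q ^ 0 * hyperbolicCount q s + q ^ s * 1) * q ^ k + 1)
      = (((a : ℤ) - ((1 : ℤˣ) : ℤ) * b) * (q - 1) - 1).toNat := by
    apply natSub_eq_toNat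
    push_cast at hGz ⊢
    linear_combination haq - hGz - hbz
  have e3 : q ^ (m + 1) - (q ^ 0 * hyperbolicCount q s + q ^ s * 0) * q ^ k
      = ((a : ℤ) * (q - 1) + ((1 : ℤˣ) : ℤ) * b).toNat := by
    apply natSub_eq_toNat
    push_cast at hGz ⊢
    linear_combination haq - hGz
  have e4 : q ^ (m + 1) - ((q ^ 0 * hyperbolicCount q s + q ^ s * 0) * q ^ k + 1)
      = ((a : ℤ) * (q - 1) + ((1 : ℤˣ) : ℤ) * b - 1).toNat := by
    apply natSub_eq_toNat
    push_cast at hGz ⊢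
    linear_combination haq - hGz
  have e5 : q ^ (m + 1) - q ^ m = ((a : ℤ) * (q - 1)).toNat := by
    apply natSub_eq_toNat
    rw [ha]; push_cast; ring
  have e6 : q ^ (m + 1) - (q ^ m + 1) = ((a : ℤ) * (q - 1) - 1).toNat := by
    apply natSub_eq_toNat
    rw [ha]; push_cast; ring
  simp only [omega, e1, e2, e3, e4, e5, e6, Nat.add_sub_cancel, ← smul_eq_C_mul]
  rw [show ((q : ℤ) ^ m) = a by rw [ha]; push_cast; rfl,
    show ((q : ℤ) ^ (m + 1 - s - 1)) = b by rw [hb]; push_cast; rfl]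
  have z1 : (q : ℚ) ^ (2 * (s : ℤ) - 1) = ((q : ℚ) ^ s) ^ 2 / q := by
    rw [zpow_sub_one₀ hq0, show 2 * (s : ℤ) = ((2 * s : ℕ) : ℤ) by push_cast; rfl, zpow_natCast]
    ring
  have z2 : (q : ℚ) ^ ((s : ℤ) - 1) = (q : ℚ) ^ s / q := by
    rw [zpow_sub_one₀ hq0, zpow_natCast, div_eq_mul_inv]
  have z3 : (q : ℚ) ^ (m + 1) = ((q : ℚ) ^ s) ^ 2 * (q : ℚ) ^ k := by
    rw [hm]; ring
  have z4 : (q : ℚ) ^ (2 * s) = ((q : ℚ) ^ s) ^ 2 := by ring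
  have z5 : (q : ℚ) ^ (2 * s + 0) = ((q : ℚ) ^ s) ^ 2 := by ring
  simp only [z1, z2, z3, z4, z5, Units.val_one, Int.cast_one, if_true, one_ne_zero, if_false]
  match_scalars <;> field_simp <;> ring

/-- The weight enumerator of the coset of an elliptic form. -/
lemma Decomposes.affineSum_elliptic [Fintype (Module.Dual F V)] {q m s k : ℕ}
    (hq : Fintype.card F = q) {Q : QuadraticForm F V} {R : QuadraticForm F (Fin 2 → F)}
    (hR : R.Anisotropic) (h : Decomposes Q s 2 k R)
    (hm : m + 1 = 2 * s + 2 + k) :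
    affineSum Q (fun n => (X : ℚ[X]) ^ (q ^ (m + 1) - n)) (fun n => X ^ (q ^ (m + 1) - (n + 1)))
      = omega q (m + 1) (Sum.inr (s + 1, -1)) := by
  have : Finite (Module.Dual F (Fin 2 → F)) := Module.finite_of_finite F
  let _ : Fintype (Module.Dual F (Fin 2 → F)) := Fintype.ofFinite _
  have hq1 : 1 ≤ q := hq ▸ Fintype.card_pos
  have hq0 : (q : ℚ) ≠ 0 := by positivity
  rw [h.affineSum_eq hq hm _ _ _ _ (fun _ => rfl) (fun _ => rfl),
    affineSum_two (by simp) R hR, hq]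
  -- `q * a` is the number of points; the numbers of zeros are expressed through `a` and `b`
  obtain ⟨b, hb⟩ : ∃ b, b = q ^ (m + 1 - (s + 1) - 1) := ⟨_, rfl⟩
  obtain ⟨a, ha⟩ : ∃ a, a = q ^ m := ⟨_, rfl⟩
  have hbq : q ^ s * q ^ k = b := by
    rw [hb, ← pow_add]
    congr 1
    omega
  have hG : q ^ 2 * hyperbolicCount q s * q ^ k + q * b = a := by
    have h1 := mul_hyperbolicCount_add hq1 s
    have h2 : q * (q ^ 2 * hyperbolicCount q s * q ^ k + q * b) = q * a := by
      rw [← hbq, ha, ← pow_succ', hm]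
      calc _ = q ^ 2 * ((q * hyperbolicCount q s + q ^ s) * q ^ k) := by ring
        _ = _ := by rw [h1]; ring
    exact Nat.eq_of_mul_eq_mul_left hq1 h2
  have hGz : (q : ℤ) ^ 2 * hyperbolicCount q s * q ^ k = a - q * b := by
    rw [← hG]; push_cast; ring
  have hbz : (q : ℤ) ^ s * (q : ℤ) ^ k = b := by exact_mod_cast hbq
  have haq : ((q : ℤ) ^ (m + 1)) = q * a := by rw [ha]; push_cast; ring
  have e1 : q ^ (m + 1) - (q ^ 2 * hyperbolicCount q s + q ^ s * 1) * q ^ k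
      = (((a : ℤ) - ((-1 : ℤˣ) : ℤ) * b) * (q - 1)).toNat := by
    apply natSub_eq_toNat
    push_cast
    linear_combination haq - hGz - hbz
  have e2 : q ^ (m + 1) - ((q ^ 2 * hyperbolicCount q s + q ^ s * 1) * q ^ k + 1)
      = (((a : ℤ) - ((-1 : ℤˣ) : ℤ) * b) * (q - 1) - 1).toNat := by
    apply natSub_eq_toNat
    push_cast
    linear_combination haq - hGz - hbz
  have e3 : q ^ (m + 1) - (q ^ 2 * hyperbolicCount q s + q ^ s * (q + 1)) * q ^ k
      = ((a : ℤ) * (q - 1) + ((-1 : ℤˣ) : ℤ) * b).toNat := by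
    apply natSub_eq_toNat
    push_cast
    linear_combination haq - hGz - (q + 1) * hbz
  have e4 : q ^ (m + 1) - ((q ^ 2 * hyperbolicCount q s + q ^ s * (q + 1)) * q ^ k + 1)
      = ((a : ℤ) * (q - 1) + ((-1 : ℤˣ) : ℤ) * b - 1).toNat := by
    apply natSub_eq_toNat
    push_cast
    linear_combination haq - hGz - (q + 1) * hbz
  have e5 : q ^ (m + 1) - q ^ m = ((a : ℤ) * (q - 1)).toNat := by
    apply natSub_eq_toNat
    rw [ha]; push_cast; ring
  have e6 : q ^ (m + 1) - (q ^ m + 1) = ((a : ℤ) * (q - 1) - 1).toNat := by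
    apply natSub_eq_toNat
    rw [ha]; push_cast; ring
  simp only [omega, e1, e2, e3, e4, e5, e6, Nat.add_sub_cancel, ← smul_eq_C_mul]
  rw [show ((q : ℤ) ^ m) = a by rw [ha]; push_cast; rfl,
    show ((q : ℤ) ^ (m + 1 - (s + 1) - 1)) = b by rw [hb]; push_cast; rfl]
  have z1 : (q : ℚ) ^ (2 * ((s + 1 : ℕ) : ℤ) - 1) = ((q : ℚ) ^ s) ^ 2 * q := by
    rw [show 2 * ((s + 1 : ℕ) : ℤ) - 1 = ((2 * s + 1 : ℕ) : ℤ) by push_cast; ring, zpow_natCast]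
    ring
  have z2 : (q : ℚ) ^ (((s + 1 : ℕ) : ℤ) - 1) = (q : ℚ) ^ s := by
    rw [show ((s + 1 : ℕ) : ℤ) - 1 = (s : ℤ) by push_cast; ring, zpow_natCast]
  have z3 : (q : ℚ) ^ (m + 1) = ((q : ℚ) ^ s) ^ 2 * (q : ℚ) ^ 2 * (q : ℚ) ^ k := by
    rw [hm]; ring
  have z4 : (q : ℚ) ^ (2 * (s + 1)) = ((q : ℚ) ^ s) ^ 2 * (q : ℚ) ^ 2 := by ring
  have z5 : (q : ℚ) ^ (2 * s + 2) = ((q : ℚ) ^ s) ^ 2 * (q : ℚ) ^ 2 := by ring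
  have z6 : (q : ℚ) ^ (2 * s) = ((q : ℚ) ^ s) ^ 2 := by ring
  simp only [z1, z2, z3, z4, z5, z6, Units.val_neg, Units.val_one, Int.cast_neg, Int.cast_one,
    if_true, one_ne_zero, if_false]
  match_scalars <;> field_simp <;> ring

/-- The weight enumerator of the coset of a form of odd rank. -/
lemma Decomposes.affineSum_odd [Fintype (Module.Dual F V)] {q m s k : ℕ}
    (hq : Fintype.card F = q) {Q : QuadraticForm F V} {R : QuadraticForm F (Fin 1 → F)}
    (hR : R.Anisotropic) (h : Decomposes Q s 1 k R) (hm : m + 1 = 2 * s + 1 + k) :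
    affineSum Q (fun n => (X : ℚ[X]) ^ (q ^ (m + 1) - n)) (fun n => X ^ (q ^ (m + 1) - (n + 1)))
      = omega q (m + 1) (Sum.inl s) := by
  have : Finite (Module.Dual F (Fin 1 → F)) := Module.finite_of_finite F
  let _ : Fintype (Module.Dual F (Fin 1 → F)) := Fintype.ofFinite _
  have hq1 : 1 ≤ q := hq ▸ Fintype.card_pos
  have hq0 : (q : ℚ) ≠ 0 := by positivity
  rw [h.affineSum_eq hq hm _ _ _ _ (fun _ => rfl) (fun _ => rfl),
    affineSum_one (LinearEquiv.funUnique (Fin 1) F F).symm R hR, hq]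
  -- `q * a` is the number of points; the numbers of zeros are expressed through `a` and `b`
  obtain ⟨b, hb⟩ : ∃ b, b = q ^ (m + 1 - s - 1) := ⟨_, rfl⟩
  obtain ⟨a, ha⟩ : ∃ a, a = q ^ m := ⟨_, rfl⟩
  obtain ⟨G, hGdef⟩ : ∃ G, G = q ^ 1 * hyperbolicCount q s * q ^ k := ⟨_, rfl⟩
  obtain ⟨t, ht⟩ : ∃ t, t = a * (q - 1) := ⟨_, rfl⟩
  have hbq : q ^ s * q ^ k = b := by
    rw [hb, ← pow_add]
    congr 1
    omega
  have hG : G + b = a := by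
    rw [hGdef, ← hbq, ha, pow_one, ← add_mul, mul_hyperbolicCount_add hq1, ← pow_add, ← pow_add]
    congr 1
    omega
  have hM (n : ℕ) : (q ^ 1 * hyperbolicCount q s + q ^ s * n) * q ^ k = G + b * n := by
    rw [hGdef, ← hbq]
    ring
  have haq : q ^ (m + 1) = t + a := by
    rw [ht, pow_succ, ← ha, ← Nat.mul_succ, Nat.succ_eq_add_one, Nat.sub_add_cancel hq1]
  have e1 : t + a - (G + b * 2 + 1) = t - b - 1 := by omega
  have e2 : t + a - (G + b * 2) = t - b := by omega
  have e3 : t + a - (G + b * 1 + 1) = t - 1 := by omega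
  have e4 : t + a - (G + b * 1) = t := by omega
  have e5 : t + a - (G + b * 0 + 1) = t + b - 1 := by omega
  have e6 : t + a - (G + b * 0) = t + b := by omega
  have e7 : t + a - a = t := by omega
  have e8 : t + a - (a + 1) = t - 1 := by omega
  simp only [omega, hM, haq, ← ha, ← hb, ← ht, e1, e2, e3, e4, e5, e6, e7, e8,
    Nat.add_sub_cancel, ← smul_eq_C_mul]
  have z3 : (q : ℚ) ^ (m + 1) = ((q : ℚ) ^ s) ^ 2 * q * (q : ℚ) ^ k := by
    rw [hm]; ring
  have z4 : (q : ℚ) ^ (2 * s) = ((q : ℚ) ^ s) ^ 2 := by ring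
  have z5 : (q : ℚ) ^ (2 * s + 1) = ((q : ℚ) ^ s) ^ 2 * q := by ring
  simp only [z3, z4, z5, if_true, one_ne_zero, if_false]
  match_scalars <;> field_simp <;> ring

end Enumerator

/-! ### Classes of forms and distance enumerators -/

section Index

variable {F : Type*} [Field F] [Fintype F] [DecidableEq F] {V : Type*} [AddCommGroup V] [Module F V]

lemma Decomposes.zeros_eq {q s r k : ℕ} (hq : Fintype.card F = q)
    {Q : QuadraticForm F V} {R : QuadraticForm F (Fin r → F)} (hR : R.Anisotropic)
    (h : Decomposes Q s r k R) : zeros Q = (q ^ r * hyperbolicCount q s + q ^ s) * q ^ k := by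
  subst hq
  obtain ⟨e, he⟩ := h
  have hQ : (Q : V → F) = fun x => (fun p : ((Fin s → F) × (Fin s → F)) ×
      ((Fin r → F) × (Fin k → F)) => p.1.1 ⬝ᵥ p.1.2 + R p.2.1) (e x) := funext he
  have h1 : zeros (fun p : (Fin r → F) × (Fin k → F) => R p.1) = Fintype.card F ^ k := by
    have : {p : (Fin r → F) × (Fin k → F) | R p.1 = 0} = {0} ×ˢ Set.univ := by
      ext p
      simp only [Set.mem_ofPred_eq, Set.mem_prod, Set.mem_singleton_iff, Set.mem_univ, and_true]
      exact ⟨hR _, fun h => by rw [h, map_zero]⟩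
    rw [zeros, this, Set.ncard_prod, Set.ncard_singleton, Set.ncard_univ]
    simp
  rw [hQ]
  refine (zeros_comp_equiv e.toEquiv (fun p : ((Fin s → F) × (Fin s → F)) ×
    ((Fin r → F) × (Fin k → F)) => p.1.1 ⬝ᵥ p.1.2 + R p.2.1)).trans ?_
  rw [zeros_dotProduct_add s (fun p : (Fin r → F) × (Fin k → F) => R p.1), h1]
  simp only [Nat.card_eq_fintype_card, Fintype.card_prod, Fintype.card_pi, Finset.prod_const,
    Finset.card_univ, Fintype.card_fin]
  ring

/-- Hyperbolic and elliptic forms of the same rank have different numbers of zeros. -/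
lemma Decomposes.not_elliptic {s k : ℕ} {Q : QuadraticForm F V} {R₀ : QuadraticForm F (Fin 0 → F)}
    {R : QuadraticForm F (Fin 2 → F)} (hR : R.Anisotropic) (h₀ : Decomposes Q (s + 1) 0 k R₀) :
    ¬ Decomposes Q s 2 k R := by
  intro h
  have hq : 1 < Fintype.card F := Fintype.one_lt_card
  set q := Fintype.card F with hq_def
  have h1 := h₀.zeros_eq hq_def.symm (fun z _ => Subsingleton.elim z 0)
  rw [h.zeros_eq hq_def.symm hR] at h1
  have h2 := Nat.eq_of_mul_eq_mul_right (by positivity) h1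
  have h3 := mul_hyperbolicCount_add hq.le s
  have h4 := mul_hyperbolicCount_add hq.le (s + 1)
  zify at h2 h3 h4
  have h5 : (2 * (q : ℤ) ^ (s + 1)) * ((q : ℤ) - 1) = 0 := by
    linear_combination -(q : ℤ) * h2 + (q : ℤ) ^ 2 * h3 - h4
  have h6 : (q : ℤ) - 1 ≠ 0 := by omega
  have h7 : (2 * (q : ℤ) ^ (s + 1)) ≠ 0 := by positivity
  exact mul_ne_zero h7 h6 h5

/-- Every quadratic form lies in exactly one class, and the weight enumerator of its coset of
the affine functions is the polynomial attached to that class. -/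
lemma exists_unique_index [Module.Finite F V] [Fintype (Module.Dual F V)] {q m : ℕ}
    (hq : Fintype.card F = q) (hm : Module.finrank F V = m + 1) (Q : QuadraticForm F V) :
    ∃ i₀ ∈ indices (m + 1), (∀ i, Q ∈ formClass F V i ↔ i = i₀) ∧
      affineSum Q (fun n => (X : ℚ[X]) ^ (q ^ (m + 1) - n)) (fun n => X ^ (q ^ (m + 1) - (n + 1)))
        = omega q (m + 1) i₀ := by
  obtain ⟨s, r, k, R, hr, hR, h⟩ := exists_decomposes Q
  have hdim := h.finrank_eq
  have hrank := h.rank_eq hR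
  have hodd (s' : ℕ) : Q ∈ formClass F V (Sum.inl s') ↔ rank Q = 2 * s' + 1 := Iff.rfl
  have heven (s' : ℕ) (τ : ℤˣ) : Q ∈ formClass F V (Sum.inr (s', τ)) ↔
    rank Q = 2 * s' ∧ ((τ = 1 ∧ IsHyperbolic s' Q) ∨ (τ = -1 ∧ IsElliptic s' Q)) := Iff.rfl
  have hm' := hm.symm.trans hdim
  interval_cases r
  · refine ⟨Sum.inr (s, 1), ?_, ?_, h.affineSum_hyperbolic hq hm'⟩
    · simp [indices]
      omega
    · have hR0 : R = 0 := by
        ext z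
        rw [Subsingleton.elim z 0, map_zero, map_zero]
      subst hR0
      have hhyp : IsHyperbolic s Q := (isHyperbolic_iff hdim).2 h
      have hell : ¬ IsElliptic s Q := by
        intro hell
        obtain ⟨s, rfl⟩ := Nat.exists_eq_add_of_le' hell.1
        obtain ⟨R, hR, h'⟩ := (isElliptic_succ_iff (k := k) (by omega)).1 hell
        exact h.not_elliptic hR h'
      rintro (s' | ⟨s', τ⟩)
      · rw [hodd]
        simp
        omega
      · rw [heven]
        simp only [Sum.inr.injEq, Prod.mk.injEq]
        constructor
        · rintro ⟨h1, h2⟩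
          obtain rfl : s' = s := by omega
          rcases h2 with ⟨h2, -⟩ | ⟨-, h2⟩
          · exact ⟨rfl, h2⟩
          · exact absurd h2 hell
        · rintro ⟨rfl, rfl⟩
          exact ⟨by omega, Or.inl ⟨rfl, hhyp⟩⟩
  · refine ⟨Sum.inl s, ?_, ?_, h.affineSum_odd hq hR hm'⟩
    · simp [indices]
      omega
    · rintro (s' | ⟨s', τ⟩)
      · rw [hodd, Sum.inl.injEq]
        omega
      · rw [heven]
        simp
        omega
  · refine ⟨Sum.inr (s + 1, -1), ?_, ?_, h.affineSum_elliptic hq hR hm'⟩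
    · simp [indices]
      omega
    · have hell : IsElliptic (s + 1) Q := (isElliptic_succ_iff hdim).2 ⟨R, hR, h⟩
      have hhyp : ¬ IsHyperbolic (s + 1) Q := by
        intro hhyp
        exact ((isHyperbolic_iff (k := k) (by omega)).1 hhyp).not_elliptic hR h
      rintro (s' | ⟨s', τ⟩)
      · rw [hodd]
        simp
        omega
      · rw [heven]
        simp only [Sum.inr.injEq, Prod.mk.injEq]
        constructor
        · rintro ⟨h1, h2⟩
          obtain rfl : s' = s + 1 := by omega
          rcases h2 with ⟨-, h2⟩ | ⟨h2, -⟩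
          · exact absurd h2 hhyp
          · exact ⟨rfl, h2⟩
        · rintro ⟨rfl, rfl⟩
          exact ⟨by omega, Or.inr ⟨rfl, hell⟩⟩

end Index

section Codes

variable {F : Type*} [Field F] {V : Type*} [AddCommGroup V] [Module F V]

/-- The number of nonzero values at the nonzero points. -/
lemma weight_puncture_eq [Finite V] [DecidableEq F] (f : V → F) :
    weight (puncture f) = Nat.card V - (zeros f + if f 0 = 0 then 0 else 1) := by
  classical
  have := Fintype.ofFinite V
  have h1 : weight (puncture f) = {x | x ≠ 0 ∧ f x ≠ 0}.ncard := by
    rw [weight, ← Set.ncard_image_of_injective _ Subtype.val_injective]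
    congr 1
    ext x
    simp [puncture, and_comm]
  have h2 : (∑ x : V, if x = 0 then (if f 0 = 0 then 0 else 1) else 0)
      = if f 0 = 0 then 0 else 1 := by simp
  have h3 : weight (puncture f) + (zeros f + if f 0 = 0 then 0 else 1) = Nat.card V := by
    rw [h1, zeros, ncard_setOf_eq_sum, ncard_setOf_eq_sum, ← h2, ← Finset.sum_add_distrib,
      ← Finset.sum_add_distrib, Nat.card_eq_fintype_card, Fintype.card, Finset.card_eq_sum_ones]
    refine Finset.sum_congr rfl fun x _ => ?_
    by_cases hx : x = 0
    · subst hx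
      by_cases hf : f 0 = 0 <;> simp [hf]
    · by_cases hf : f x = 0 <;> simp [hx, hf]
  omega

/-- The function `Q + l + c` on `V`, for a triple `(Q, l, c)`. -/
def cosetFun (p : QuadraticForm F V × Module.Dual F V × F) : V → F :=
  fun x => p.1 x + p.2.1 x + p.2.2

lemma cosetFun_sub (p p' : QuadraticForm F V × Module.Dual F V × F) :
    cosetFun p - cosetFun p' = cosetFun (p - p') := by
  ext x
  simp [cosetFun]
  ring

lemma code_eq_image (Y : Set (QuadraticForm F V)) :
    code Y = cosetFun '' {p | p.1 ∈ Y} := by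
  ext f
  simp only [code, affineFunctions, Set.mem_iUnion, Set.mem_ofPred_eq, Set.mem_image]
  constructor
  · rintro ⟨Q, hQ, g, ⟨a, ha⟩, rfl⟩
    refine ⟨(Q, a.linear, a 0), hQ, ?_⟩
    ext x
    have h1 := congrFun (AffineMap.decomp a) x
    simp only [Pi.add_apply] at h1
    simp [cosetFun, ha, h1, add_assoc]
  · rintro ⟨⟨Q, l, c⟩, hQ, rfl⟩
    refine ⟨Q, hQ, fun x => l x + c, ⟨l.toAffineMap + AffineMap.const F V c, fun x => by simp⟩, ?_⟩
    ext x
    simp [cosetFun, add_assoc]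

/-- A quadratic form that agrees with a linear function vanishes, unless `q = 2` and its rank is
one: then `x ^ 2 = x`. -/
lemma eq_zero_of_eq_linear {Q : QuadraticForm F V} {l : Module.Dual F V} (h : ∀ x, Q x = l x)
    (hnd : 2 < Nat.card F ∨ rank Q ≠ 1) : l = 0 := by
  rcases hnd with hnd | hnd
  · -- compare the quadratic and the linear behaviour under a scalar other than `0` and `1`
    obtain ⟨a, ha0, ha1⟩ : ∃ a : F, a ≠ 0 ∧ a ≠ 1 := by
      by_contra! ha
      have : Finite F := Nat.finite_of_card_ne_zero (by omega)
      have h1 : (Set.univ : Set F) ⊆ {0, 1} := by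
        intro a _
        by_cases h0 : a = 0
        · simp [h0]
        · simp [ha a h0]
      have h2 := Set.ncard_le_ncard h1
      rw [Set.ncard_univ, Set.ncard_pair zero_ne_one] at h2
      omega
    ext x
    have h1 := h (a • x)
    rw [QuadraticMap.map_smul, map_smul, h, smul_eq_mul, smul_eq_mul] at h1
    have h2 : a * (a - 1) * l x = 0 := by linear_combination h1
    exact (mul_eq_zero.1 h2).resolve_left (mul_ne_zero ha0 (sub_ne_zero.2 ha1))
  · -- the polar form vanishes, so that the radical is the kernel of `l`
    by_contra hl
    apply hnd
    have hker : QuadraticMap.radical Q = LinearMap.ker l := by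
      ext x
      rw [QuadraticMap.mem_radical_iff', LinearMap.mem_ker, h]
      refine ⟨fun h1 => h1.1, fun h1 => ⟨h1, fun y => ?_⟩⟩
      rw [h, h, map_add, h1, zero_add]
    rw [rank, hker, (l.quotKerEquivOfSurjective (LinearMap.surjective hl)).finrank_eq,
      Module.finrank_self]

/-- The cosets of the forms in a nondegenerate set are disjoint. -/
lemma injOn_cosetFun {Y : Set (QuadraticForm F V)} (hnd : Nondegenerate Y) :
    Set.InjOn cosetFun {p : QuadraticForm F V × Module.Dual F V × F | p.1 ∈ Y} := by
  rintro ⟨A, l, c⟩ hA ⟨B, l', c'⟩ hB h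
  have h0 : c = c' := by simpa [cosetFun] using congrFun h 0
  subst h0
  have h1 (x : V) : (A - B) x = (l' - l) x := by
    have := congrFun h x
    simp only [cosetFun] at this
    rw [_root_.sub_apply, LinearMap.sub_apply]
    linear_combination this
  have h2 : l' - l = 0 := eq_zero_of_eq_linear h1 (hnd.imp id fun h => h A hA B hB)
  have h3 : A - B = 0 := by
    ext x
    rw [h1, h2]
    rfl
  rw [sub_eq_zero.1 h2, sub_eq_zero.1 h3]

/-- A function of degree at most two that vanishes at all nonzero points vanishes at the origin,
unless its degree can reach the dimension times `q - 1`. -/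
lemma eq_zero_of_vanish_off_zero [Finite F] {m : ℕ} (hm : Module.finrank F V = m)
    (hmq : 2 < m * (Nat.card F - 1)) (Q : QuadraticForm F V) (l : Module.Dual F V) (c : F)
    (h : ∀ x, x ≠ 0 → Q x + l x + c = 0) : c = 0 := by
  classical
  have := Fintype.ofFinite F
  have hm0 : 0 < m := Nat.pos_of_ne_zero (by rintro rfl; simp at hmq)
  by_cases h4 : 3 < Nat.card F
  · -- on a line, a polynomial of degree less than `q - 1` sums to zero
    have : Nontrivial V := Module.nontrivial_of_finrank_pos (R := F) (by omega)
    obtain ⟨x, hx⟩ := exists_ne (0 : V)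
    rw [Nat.card_eq_fintype_card] at h4
    have h1 : ∑ t : F, (Q x * t ^ 2 + l x * t ^ 1 + c * t ^ 0) = 0 := by
      rw [Finset.sum_add_distrib, Finset.sum_add_distrib, ← Finset.mul_sum, ← Finset.mul_sum,
        ← Finset.mul_sum, FiniteField.sum_pow_lt_card_sub_one F 2 (by omega),
        FiniteField.sum_pow_lt_card_sub_one F 1 (by omega),
        FiniteField.sum_pow_lt_card_sub_one F 0 (by omega)]
      simp
    rw [Finset.sum_eq_single_of_mem 0 (Finset.mem_univ _)] at h1
    · simpa using h1
    · intro t _ ht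
      have := h (t • x) (smul_ne_zero ht hx)
      rw [QuadraticMap.map_smul, map_smul, smul_eq_mul, smul_eq_mul] at this
      linear_combination this
  by_cases h3 : 3 ≤ m
  · -- the third difference of a function of degree two is zero
    obtain ⟨v, hv⟩ := exists_linearIndependent_of_le_finrank (R := F) (M := V) (hm ▸ h3)
    have hne (a b d : F) (h0 : a ≠ 0 ∨ b ≠ 0 ∨ d ≠ 0) :
        Q (a • v 0 + b • v 1 + d • v 2) + l (a • v 0 + b • v 1 + d • v 2) + c = 0 := by
      refine h _ fun h1 => ?_
      have h2 := Fintype.linearIndependent_iff.1 hv ![a, b, d] (by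
        simpa [Fin.sum_univ_three] using h1)
      have ha := h2 0
      have hb := h2 1
      have hd := h2 2
      simp at ha hb hd
      simp [ha, hb, hd] at h0
    have e1 := hne 1 0 0 (by simp)
    have e2 := hne 0 1 0 (by simp)
    have e3 := hne 0 0 1 (by simp)
    have e4 := hne 1 1 0 (by simp)
    have e5 := hne 1 0 1 (by simp)
    have e6 := hne 0 1 1 (by simp)
    have e7 := hne 1 1 1 (by simp)
    simp only [one_smul, zero_smul, add_zero, zero_add, map_add, QuadraticMap.map_add Q,
      QuadraticMap.polar_add_left] at e1 e2 e3 e4 e5 e6 e7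
    linear_combination e7 - e4 - e5 - e6 + e1 + e2 + e3
  · -- the parallelogram law over the field with three elements
    have hF : Nat.card F = 3 := by
      by_contra hne
      have : m * (Nat.card F - 1) ≤ 2 * 1 := Nat.mul_le_mul (by omega) (by omega)
      omega
    have hm2 : 2 ≤ m := by
      by_contra hlt
      have : m * (Nat.card F - 1) ≤ 1 * 2 := Nat.mul_le_mul (by omega) (by omega)
      omega
    have h2 : (2 : F) ≠ 0 := by
      apply Ring.two_ne_zero
      intro h2
      obtain ⟨n, -, hn⟩ := FiniteField.card F (ringChar F)
      rw [h2, ← Nat.card_eq_fintype_card, hF] at hn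
      have := dvd_pow_self 2 n.pos.ne'
      omega
    have hQ (x : V) (hx : x ≠ 0) : Q x = -c := by
      have e1 := h x hx
      have e2 := h (-x) (neg_ne_zero.2 hx)
      rw [QuadraticMap.map_neg, map_neg] at e2
      apply mul_left_cancel₀ h2
      linear_combination e1 + e2
    obtain ⟨v, hv⟩ := exists_linearIndependent_of_le_finrank (R := F) (M := V) (hm ▸ hm2)
    have hne (a b : F) (h0 : a ≠ 0 ∨ b ≠ 0) : Q (a • v 0 + b • v 1) = -c := by
      refine hQ _ fun h1 => ?_
      have h2 := Fintype.linearIndependent_iff.1 hv ![a, b] (by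
        simpa [Fin.sum_univ_two] using h1)
      have ha := h2 0
      have hb := h2 1
      simp at ha hb
      simp [ha, hb] at h0
    have e1 := hne 1 0 (by simp)
    have e2 := hne 0 1 (by simp)
    have e3 := hne 1 1 (by simp)
    have e4 := hne 1 (-1) (by simp)
    simp only [one_smul, zero_smul, add_zero, zero_add, neg_smul, QuadraticMap.map_add Q,
      QuadraticMap.polar_neg_right, QuadraticMap.map_neg] at e1 e2 e3 e4
    apply mul_left_cancel₀ h2
    linear_combination 2 * e1 + 2 * e2 - e3 - e4

lemma injOn_puncture [Finite F] {m : ℕ} (hm : Module.finrank F V = m)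
    (hmq : 2 < m * (Nat.card F - 1)) (Y : Set (QuadraticForm F V)) :
    Set.InjOn puncture (code Y) := by
  rw [code_eq_image]
  rintro _ ⟨p, -, rfl⟩ _ ⟨p', -, rfl⟩ h
  have h1 (x : V) (hx : x ≠ 0) : cosetFun (p - p') x = 0 := by
    rw [← cosetFun_sub, Pi.sub_apply, sub_eq_zero]
    exact congrFun h ⟨x, hx⟩
  have h2 : (p - p').2.2 = 0 := eq_zero_of_vanish_off_zero hm hmq _ _ _ h1
  rw [← sub_eq_zero, cosetFun_sub]
  ext x
  by_cases hx : x = 0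
  · rw [hx]
    simpa [cosetFun] using h2
  · exact h1 x hx

/-- The distance enumerator of a code with an injective parametrization. -/
lemma distanceEnumerator_image {ι A : Type*} [AddGroup A] [Finite A] (wt : A → ℕ) (S : Finset ι)
    (φ : ι → A) (hφ : Set.InjOn φ S) :
    distanceEnumerator wt (φ '' S)
      = (S.card : ℚ)⁻¹ • ∑ s ∈ S, ∑ t ∈ S, (X : ℚ[X]) ^ wt (φ t - φ s) := by
  classical
  have h1 : (Set.toFinite (φ '' S)).toFinset = S.image φ := by
    ext; simp
  rw [distanceEnumerator, h1, ← smul_eq_C_mul, hφ.ncard_image, Set.ncard_coe_finset,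
    Finset.sum_image hφ]
  congr 1
  exact Finset.sum_congr rfl fun s _ => Finset.sum_image hφ

end Codes

section Main

variable {F : Type*} [Field F] [Fintype F] [DecidableEq F] {V : Type*} [AddCommGroup V]
  [Module F V] [Finite V]

/-- The weight enumerator of the coset of `Q` as an affine sum. -/
lemma affineSum_eq_sum_weight [Fintype (Module.Dual F V)] (Q : QuadraticForm F V) :
    ∑ p : Module.Dual F V × F, (X : ℚ[X]) ^ weight (puncture (cosetFun (Q, p)))
      = affineSum Q (fun n => X ^ (Nat.card V - n)) (fun n => X ^ (Nat.card V - (n + 1))) := by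
  rw [Fintype.sum_prod_type, affineSum]
  refine Finset.sum_congr rfl fun l _ => Finset.sum_congr rfl fun c _ => ?_
  rw [weight_puncture_eq]
  have h0 : cosetFun (Q, l, c) 0 = c := by simp [cosetFun]
  rw [h0]
  split_ifs <;> rfl

/-- The sum of `z ^ wt (c - b)` over all pairs of codewords, the codewords being parametrized
by triples. Its inner sums only depend on the differences of the quadratic forms. -/
lemma sum_pairs_eq [Fintype (Module.Dual F V)] (S : Finset (QuadraticForm F V)) :
    ∑ s ∈ S ×ˢ (Finset.univ : Finset (Module.Dual F V × F)),
      ∑ t ∈ S ×ˢ (Finset.univ : Finset (Module.Dual F V × F)),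
        (X : ℚ[X]) ^ weight (puncture (cosetFun t - cosetFun s))
      = (Fintype.card (Module.Dual F V × F) : ℚ) • ∑ p ∈ S ×ˢ S,
        affineSum (p.1 - p.2) (fun n => X ^ (Nat.card V - n))
          (fun n => X ^ (Nat.card V - (n + 1))) := by
  simp only [Finset.sum_product, cosetFun_sub]
  rw [Finset.sum_congr rfl (fun _ _ => Finset.sum_comm), Finset.sum_comm, Finset.smul_sum]
  refine Finset.sum_congr rfl fun B _ => ?_
  rw [Finset.smul_sum]
  refine Finset.sum_congr rfl fun A _ => ?_
  have h1 (u : Module.Dual F V × F) :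
      (∑ w : Module.Dual F V × F, (X : ℚ[X]) ^ weight (puncture (cosetFun ((B, w) - (A, u)))))
        = affineSum (B - A) (fun n => X ^ (Nat.card V - n))
          (fun n => X ^ (Nat.card V - (n + 1))) := by
    rw [← affineSum_eq_sum_weight]
    exact Equiv.sum_comp (Equiv.subRight u)
      (fun w => (X : ℚ[X]) ^ weight (puncture (cosetFun (B - A, w))))
  rw [Finset.sum_congr rfl (fun u _ => h1 u), Finset.sum_const, Finset.card_univ,
    Nat.cast_smul_eq_nsmul]

/-- Sums weighted by the inner distribution are sums over all pairs of forms, as every difference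
lies in exactly one class. -/
lemma sum_innerDist_mul {Y : Set (QuadraticForm F V)} {S : Finset (QuadraticForm F V)}
    (hS : (S : Set (QuadraticForm F V)) = Y) (I : Finset Index) (w : Index → ℚ[X])
    (P : QuadraticForm F V → ℚ[X])
    (hP : ∀ Q, ∃ i₀ ∈ I, (∀ i, Q ∈ formClass F V i ↔ i = i₀) ∧ P Q = w i₀) :
    ∑ i ∈ I, C (innerDist Y i) * w i = (S.card : ℚ)⁻¹ • ∑ p ∈ S ×ˢ S, P (p.1 - p.2) := by
  classical
  subst hS
  have h1 (i : Index) : innerDist (S : Set (QuadraticForm F V)) i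
      = (S.card : ℚ)⁻¹ * ∑ p ∈ S ×ˢ S, if p.1 - p.2 ∈ formClass F V i then 1 else 0 := by
    have h2 : {p : QuadraticForm F V × QuadraticForm F V | p.1 ∈ (S : Set (QuadraticForm F V)) ∧
        p.2 ∈ (S : Set (QuadraticForm F V)) ∧ p.1 - p.2 ∈ formClass F V i}
        = ((S ×ˢ S).filter fun p => p.1 - p.2 ∈ formClass F V i : Finset _) := by
      ext p
      simp [and_assoc]
    rw [innerDist, h2, Set.ncard_coe_finset, Set.ncard_coe_finset, Finset.sum_boole,
      div_eq_inv_mul]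
  have h2 (Q : QuadraticForm F V) :
      P Q = ∑ i ∈ I, (if Q ∈ formClass F V i then (1 : ℚ) else 0) • w i := by
    obtain ⟨i₀, hi₀, hi, hPQ⟩ := hP Q
    rw [Finset.sum_eq_single_of_mem i₀ hi₀]
    · rw [if_pos ((hi i₀).2 rfl), one_smul, hPQ]
    · intro i _ hne
      rw [if_neg (fun h => hne ((hi i).1 h)), zero_smul]
  simp only [h1, h2, ← smul_eq_C_mul, mul_smul]
  rw [← Finset.smul_sum, Finset.sum_comm]
  simp only [Finset.sum_smul]

end Main

end QuadraticCode

theorem theorem6p2 {F : Type*} [Field F] [Finite F] {V : Type*} [AddCommGroup V] [Module F V]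
    [Finite V] (q m : ℕ) (hq : Nat.card F = q) (hm : Module.finrank F V = m) (hm1 : 1 ≤ m)
    (Y : Set (QuadraticForm F V)) (hY : Y.Nonempty) (hnd : QuadraticCode.Nondegenerate Y) :
    QuadraticCode.distanceEnumerator
        (fun f : V → F => QuadraticCode.weight (QuadraticCode.puncture f)) (QuadraticCode.code Y)
      = ∑ i ∈ QuadraticCode.indices m,
          Polynomial.C (QuadraticCode.innerDist Y i) * QuadraticCode.omega q m i ∧
    (2 < m * (q - 1) →
      QuadraticCode.distanceEnumerator QuadraticCode.weight (QuadraticCode.puncturedCode Y)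
        = ∑ i ∈ QuadraticCode.indices m,
            Polynomial.C (QuadraticCode.innerDist Y i) * QuadraticCode.omega q m i) := by
  classical
  have := Fintype.ofFinite F
  obtain ⟨m, rfl⟩ := Nat.exists_eq_add_of_le' hm1
  have : Module.Finite F V := Module.Finite.of_finite
  have : Finite (Module.Dual F V) := Module.finite_of_finite F
  let _ : Fintype (Module.Dual F V) := Fintype.ofFinite _
  have : Finite (QuadraticForm F V) :=
    Finite.of_injective (fun Q : QuadraticForm F V => (Q : V → F)) DFunLike.coe_injective
  obtain ⟨S, rfl⟩ : ∃ S : Finset (QuadraticForm F V), (S : Set (QuadraticForm F V)) = Y :=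
    ⟨(Set.toFinite Y).toFinset, by simp⟩
  have hq' : Fintype.card F = q := by rw [← hq, Nat.card_eq_fintype_card]
  have hV : Nat.card V = q ^ (m + 1) := by
    rw [Module.natCard_eq_pow_finrank (K := F), hq, hm]
  rw [QuadraticCode.sum_innerDist_mul (S := S) rfl _ _ _
    (QuadraticCode.exists_unique_index hq' hm)]
  set T : Finset (QuadraticForm F V × Module.Dual F V × F) := S ×ˢ Finset.univ with hT
  have hcode : QuadraticCode.code (S : Set (QuadraticForm F V)) = QuadraticCode.cosetFun '' T := by
    rw [QuadraticCode.code_eq_image]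
    congr 1
    ext p
    simp [hT]
  have hinj : Set.InjOn QuadraticCode.cosetFun (T : Set (QuadraticForm F V × _)) :=
    (QuadraticCode.injOn_cosetFun hnd).mono fun p hp => (Finset.mem_product.1 hp).1
  have hcard : (Fintype.card (Module.Dual F V × F) : ℚ) ≠ 0 :=
    Nat.cast_ne_zero.2 Fintype.card_ne_zero
  have key : (T.card : ℚ)⁻¹ • ∑ s ∈ T, ∑ t ∈ T, (Polynomial.X : Polynomial ℚ) ^
        QuadraticCode.weight (QuadraticCode.puncture
          (QuadraticCode.cosetFun t - QuadraticCode.cosetFun s))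
      = (S.card : ℚ)⁻¹ • ∑ p ∈ S ×ˢ S, QuadraticCode.affineSum (p.1 - p.2)
        (fun n => (Polynomial.X : Polynomial ℚ) ^ (q ^ (m + 1) - n))
        (fun n => Polynomial.X ^ (q ^ (m + 1) - (n + 1))) := by
    rw [QuadraticCode.sum_pairs_eq, hV, smul_smul, hT, Finset.card_product, Finset.card_univ]
    push_cast
    rw [mul_inv, mul_assoc, inv_mul_cancel₀ (by exact_mod_cast hcard), mul_one]
  refine ⟨?_, fun hmq => ?_⟩
  · rw [hcode, QuadraticCode.distanceEnumerator_image _ _ _ hinj]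
    exact key
  · have hinj' : Set.InjOn (QuadraticCode.puncture ∘ QuadraticCode.cosetFun)
        (T : Set (QuadraticForm F V × _)) := by
      refine Set.InjOn.comp (QuadraticCode.injOn_puncture hm (by rwa [hq]) S) hinj ?_
      rw [hcode]
      exact Set.mapsTo_image _ _
    rw [QuadraticCode.puncturedCode, hcode, ← Set.image_comp,
      QuadraticCode.distanceEnumerator_image _ _ _ hinj']
    exact key
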